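/- Let $A\in\mathbb R^{n\times n}$, $B\in\mathbb R^{n\times l}$, $E\in\mathbb R^{n\times m}$, $z\in\mathbb R^n$ with $(A,B)$ stabilizable, and let $\{W(k)\}_{k\in\mathbb N_0}$ be i.i.d. square-integrable $\mathbb R^m$-valued random variables with mean $\mu_W$ on a probability space $(\Omega,\mathcal F,\mathbb P)$. Consider $$X(k+1)=f(X(k),U(k),W(k)):=AX(k)+BU(k)+EW(k)+z,\qquad X(0)=X_0\in L^2 ,$$ with solution $X_U(\cdot,X_0)$. The control processes are those for which $U(k)\in L^2$ is measurable (up to null sets) with respect to $\sigma(X(0),\dots,X(k))$ and $W(k)$ is independent of $X(k)$ and of $U(k)$, for all $k=0,\dots,N-1$. Let $Q_1,Q_2,R_2\ge 0$ and $R_1>0$ be symmetric, $s\in\mathbb R^n$, $v\in\mathbb R^l$, $c\in\mathbb R$, and put $$\ell(X,U):=\mathbb E[X^TQ_1X+U^TR_1U+s^TX+v^TU+c]+\mathrm{Tr}(Q_2\,\mathrm{Cov}(X))+\mathrm{Tr}(R_2\,\mathrm{Cov}(U)),\qquad J_N(X_0,U):=\sum_{k=0}^{N-1}\ell(X(k),U(k)).$$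 A pair of processes $(X^s(\cdot),U^s(\cdot))$ is called stationary if $X^s(k+1)=f(X^s(k),U^s(k),W(k))$, $W(k)$ is independent of $X^s(k)$ and of $U^s(k)$, and the laws of $X^s(k)$ and of $U^s(k)$ do not depend on $k$ and have finite second moments. Let $\mathcal K_\infty$ be the class of continuous, strictly increasing, unbounded $\alpha:[0,\infty)\to[0,\infty)$ with $\alpha(0)=0$. The problem is strictly dissipative in $L^2$ at $(X^s,U^s)$ with storage function $\lambda:\mathbb N_0\times L^2\to\mathbb R$ and rate $\alpha\in\mathcal K_\infty$ if $\lambda$ is bounded from below and $$\ell(X,U)-\ell(X^s(k),U^s(k))+\lambda(k,X)-\lambda(k+1,f(X,U,W(k)))\ \ge\ \alpha\big(\mathbb E\|X-X^s(k)\|^2\big)$$ for all $k\in\mathbb N_0$ and all $X,U\in L^2$ that are independent of $W(k)$. Let $W_2$ be the Wasserstein distance of order $2$ between laws (infimum of $\|\bar X-\bar Y\|_{L^2}$ over all couplings). Assume that $(x^s,u^s)$ solves $(I-A)x^s-Bu^s=E\mu_W+z$ and that $(A,Q_1^{1/2})$ is detectable. Then there exist a positive semidefinite solution $P$ of $$P=A^TPA+(Q_1+Q_2)-A^TPB[(R_1+R_2)+B^TPB]^{-1}B^TPA,$$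 a symmetric positive definite $S\in\mathbb R^{n\times n}$, $q\in\mathbb R^n$, a solution $(\tilde x,\tilde u)$ of $(I-A)\tilde x-B\tilde u=0$ and a function $\alpha$ such that, with $K:=-[(R_1+R_2)+B^TPB]^{-1}B^TPA$, the following holds. If $\Omega$ carries a uniformly distributed random variable that is independent of $\{W(k)\}_k$, then there is a stationary pair $(X^s_\star,U^s_\star)$ of the form $$U^s_\star(k)=K(X^s_\star(k)-\tilde x-x^s)+\tilde u+u^s .$$ For every stationary pair of this form: 1. The problem is strictly dissipative in $L^2$ at $(X^s_\star,U^s_\star)$ with rate $\alpha\in\mathcal K_\infty$ and storage function $$\lambda(k,X)=\mathbb E\big[\|X-(X^s_\star(k)-\tilde x)\|_{P+S}^2-\|X-x^s\|_P^2+q^T(X-(X^s_\star(k)-\tilde x))\big].$$ 2. (Turnpike in distribution.) For every $X_0\in L^2$ there is $C\in\mathbb R$ such that for every $\delta>0$, every $N$, every control process $U(\cdot)$ with $J_N(X_0,U)\le\delta+\sum_{k=0}^{N-1}\ell(X^s_\star(k),U^s_\star(k))$ and every $\varepsilon>0$, $$\mathcal D_\varepsilon:=\#\{k\in\{0,\dots,N-1\}: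 W_2(X_U(k,X_0),X^s_\star(k))\le\varepsilon\}\ \ge\ N-\frac{\delta+C}{\alpha(\sqrt\varepsilon)} .$$ 3. For every rate $\alpha'\in\mathcal K_\infty$ with which the problem is strictly dissipative in $L^2$ at $(X^s_\star,U^s_\star)$ for some storage function, the assertion of 2 holds with $\alpha'(\varepsilon^2)$ in place of $\alpha(\sqrt\varepsilon)$. -/

import Mathlib

open MeasureTheory ProbabilityTheory
open scoped ENNReal Matrix MatrixOrder

noncomputable section

namespace StochLQ

/-- Euclidean space `ℝⁿ`. -/
abbrev Vec (n : ℕ) : Type := EuclideanSpace ℝ (Fin n)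

/-- The quadratic form `xᵀ M x`, written `‖x‖²_M` when `M` is positive semidefinite. -/
def quad {n : ℕ} (M : Matrix (Fin n) (Fin n) ℝ) (x : Vec n) : ℝ :=
  inner ℝ x (M.toEuclideanLin x)

/-! ### Linear systems theory -/

/-- A real square matrix all of whose complex eigenvalues lie in the open unit disc. -/
def IsSchurStable {n : ℕ} (A : Matrix (Fin n) (Fin n) ℝ) : Prop :=
  ∀ ev ∈ spectrum ℂ (A.map (algebraMap ℝ ℂ)), ‖ev‖ < 1

def IsStabilizable {n l : ℕ} (A : Matrix (Fin n) (Fin n) ℝ) (B : Matrix (Fin n) (Fin l) ℝ) :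
    Prop :=
  ∃ F : Matrix (Fin l) (Fin n) ℝ, IsSchurStable (A + B * F)

def IsDetectable {n p : ℕ} (A : Matrix (Fin n) (Fin n) ℝ) (C : Matrix (Fin p) (Fin n) ℝ) :
    Prop :=
  ∃ L : Matrix (Fin n) (Fin p) ℝ, IsSchurStable (A + L * C)

/-- The data of the generalized stochastic linear-quadratic optimal control problem: the dynamics
`X⁺ = A X + B U + E W + z` and the coefficients of the stage cost. -/
structure Problem (n l m : ℕ) where
  A : Matrix (Fin n) (Fin n) ℝ
  B : Matrix (Fin n) (Fin l) ℝ
  E : Matrix (Fin n) (Fin m) ℝ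
  z : Vec n
  Q₁ : Matrix (Fin n) (Fin n) ℝ
  Q₂ : Matrix (Fin n) (Fin n) ℝ
  R₁ : Matrix (Fin l) (Fin l) ℝ
  R₂ : Matrix (Fin l) (Fin l) ℝ
  s : Vec n
  v : Vec l
  c : ℝ

/-- Class `𝒦_∞`; only the values on `[0, ∞)` matter. -/
structure IsKInfty (α : ℝ → ℝ) : Prop where
  continuousOn : ContinuousOn α (Set.Ici 0)
  strictMonoOn : StrictMonoOn α (Set.Ici 0)
  map_zero : α 0 = 0
  unbounded : ¬ BddAbove (α '' Set.Ici 0)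

/-- The Wasserstein distance of order `p`: the infimum of `‖X̄ - Ȳ‖_{L^p}` over all couplings
`(X̄, Ȳ)` of the two laws, a coupling being represented by its joint law. -/
def wasserstein {n : ℕ} (p : ℝ≥0∞) (ρ₁ ρ₂ : Measure (Vec n)) : ℝ≥0∞ :=
  ⨅ (π : Measure (Vec n × Vec n)) (_ : π.map Prod.fst = ρ₁ ∧ π.map Prod.snd = ρ₂),
    eLpNorm (fun q : Vec n × Vec n => q.1 - q.2) p π

variable {n l m : ℕ} {Ω : Type*} [MeasurableSpace Ω]

/-- Square-integrable random vectors. -/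
def IsL2 {d : ℕ} (μ : Measure Ω) (X : Ω → Vec d) : Prop :=
  Measurable X ∧ MemLp X 2 μ

/-- `𝒫₂(ℝᵈ)`. -/
def IsP2 {d : ℕ} (ρ : Measure (Vec d)) : Prop :=
  IsProbabilityMeasure ρ ∧ ∫⁻ x, ‖x‖ₑ ^ 2 ∂ρ < ∞

/-- The covariance matrix of a random vector. -/
def covMatrix {d : ℕ} (μ : Measure Ω) (X : Ω → Vec d) : Matrix (Fin d) (Fin d) ℝ :=
  Matrix.of fun i j => covariance (fun ω => X ω i) (fun ω => X ω j) μ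

/-- The noise: a sequence of i.i.d. square-integrable random vectors. -/
structure IsNoise (μ : Measure Ω) (W : ℕ → Ω → Vec m) : Prop where
  isL2 : ∀ k, IsL2 μ (W k)
  indep : iIndepFun W μ
  ident : ∀ k, IdentDistrib (W k) (W 0) μ μ

namespace Problem

variable (S : Problem n l m)

/-- The stage cost `ℓ(X, U)` of a pair of random vectors. -/
def stageCost (μ : Measure Ω) (X : Ω → Vec n) (U : Ω → Vec l) : ℝ :=
  (∫ ω, (quad S.Q₁ (X ω) + quad S.R₁ (U ω) + inner ℝ S.s (X ω) + inner ℝ S.v (U ω) + S.c) ∂μ)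
    + ((S.Q₂ * covMatrix μ X).trace + (S.R₂ * covMatrix μ U).trace)

/-- The dynamics `f(X, U, W) = A X + B U + E W + z`. -/
def step (X : Ω → Vec n) (U : Ω → Vec l) (W : Ω → Vec m) : Ω → Vec n := fun ω =>
  S.A.toEuclideanLin (X ω) + S.B.toEuclideanLin (U ω) + S.E.toEuclideanLin (W ω) + S.z

/-- The solution `X_U(·, X₀)`. -/
def traj (W : ℕ → Ω → Vec m) (X₀ : Ω → Vec n) (U : ℕ → Ω → Vec l) : ℕ → Ω → Vec n
  | 0 => X₀
  | k + 1 => S.step (traj W X₀ U k) (U k) (W k)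

/-- The cost functional `J_N(X₀, U)`. -/
def totalCost (μ : Measure Ω) (W : ℕ → Ω → Vec m) (N : ℕ) (X₀ : Ω → Vec n)
    (U : ℕ → Ω → Vec l) : ℝ :=
  ∑ k ∈ Finset.range N, S.stageCost μ (S.traj W X₀ U k) (U k)

/-- The `σ`-algebra `σ(X(0), …, X(k))` generated by the state process. -/
abbrev stateSigma (W : ℕ → Ω → Vec m) (X₀ : Ω → Vec n) (U : ℕ → Ω → Vec l) (k : ℕ) :
    MeasurableSpace Ω :=
  ⨆ j ∈ Finset.range (k + 1), MeasurableSpace.comap (S.traj W X₀ U j) inferInstance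

/-- Control processes on the horizon `N`: `U(k)` is square integrable and, up to null sets,
measurable with respect to `σ(X(0), …, X(k))`, and the noise `W(k)` is independent of `X(k)` and
of `U(k)`. -/
structure IsControl (μ : Measure Ω) (W : ℕ → Ω → Vec m) (N : ℕ) (X₀ : Ω → Vec n)
    (U : ℕ → Ω → Vec l) : Prop where
  isL2 : ∀ k < N, IsL2 μ (U k)
  adapted : ∀ k < N, AEStronglyMeasurable[S.stateSigma W X₀ U k] (U k) μ
  indep_state : ∀ k < N, IndepFun (W k) (S.traj W X₀ U k) μ
  indep_control : ∀ k < N, IndepFun (W k) (U k) μ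

/-- Stationary pairs of state and control processes. -/
structure IsStationaryPair (μ : Measure Ω) (W : ℕ → Ω → Vec m) (Xs : ℕ → Ω → Vec n)
    (Us : ℕ → Ω → Vec l) : Prop where
  measurable_state : ∀ k, Measurable (Xs k)
  measurable_control : ∀ k, Measurable (Us k)
  indep_state : ∀ k, IndepFun (W k) (Xs k) μ
  indep_control : ∀ k, IndepFun (W k) (Us k) μ
  law_state : ∃ ρ : Measure (Vec n), IsP2 ρ ∧ ∀ k, μ.map (Xs k) = ρ
  law_control : ∃ ρ : Measure (Vec l), IsP2 ρ ∧ ∀ k, μ.map (Us k) = ρ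
  dynamics : ∀ k, Xs (k + 1) = S.step (Xs k) (Us k) (W k)

/-- Strict dissipativity in `L²` at `(Xs, Us)` with storage function `lam` and rate `α`. The
inequality is required for all square-integrable `X`, `U` that are independent of `W(k)`. -/
structure IsStrictlyDissipative (μ : Measure Ω) (W : ℕ → Ω → Vec m) (Xs : ℕ → Ω → Vec n)
    (Us : ℕ → Ω → Vec l) (lam : ℕ → (Ω → Vec n) → ℝ) (α : ℝ → ℝ) : Prop where
  isKInfty : IsKInfty α
  bddBelow : ∃ M : ℝ, ∀ k X, IsL2 μ X → M ≤ lam k X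
  ineq : ∀ k X U, IsL2 μ X → IsL2 μ U → IndepFun (W k) X μ → IndepFun (W k) U μ →
    α (∫ ω, ‖X ω - Xs k ω‖ ^ 2 ∂μ) ≤
      S.stageCost μ X U - S.stageCost μ (Xs k) (Us k) + lam k X - lam (k + 1) (S.step X U (W k))

/-- `P` is a positive semidefinite solution of the discrete-time algebraic Riccati equation. -/
def IsRiccatiSolution (P : Matrix (Fin n) (Fin n) ℝ) : Prop :=
  P.PosSemidef ∧
    P = S.Aᵀ * P * S.A + (S.Q₁ + S.Q₂)
      - S.Aᵀ * P * S.B * ((S.R₁ + S.R₂) + S.Bᵀ * P * S.B)⁻¹ * S.Bᵀ * P * S.A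

/-- The gain `K = -[(R₁ + R₂) + Bᵀ P B]⁻¹ Bᵀ P A`. -/
def gain (P : Matrix (Fin n) (Fin n) ℝ) : Matrix (Fin l) (Fin n) ℝ :=
  -(((S.R₁ + S.R₂) + S.Bᵀ * P * S.B)⁻¹ * S.Bᵀ * P * S.A)

/-- A stationary pair that is generated by the feedback
`U(k) = K (X(k) - x̃ - xs) + ũ + us`. -/
def IsFeedbackStationaryPair (μ : Measure Ω) (W : ℕ → Ω → Vec m) (P : Matrix (Fin n) (Fin n) ℝ)
    (xs xt : Vec n) (us ut : Vec l) (Xs : ℕ → Ω → Vec n) (Us : ℕ → Ω → Vec l) : Prop :=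
  S.IsStationaryPair μ W Xs Us ∧
    ∀ k ω, Us k ω = (S.gain P).toEuclideanLin (Xs k ω - xt - xs) + ut + us

/-- `D_ε`: the number of times `k < N` at which the Wasserstein distance of order two between the
laws of `X_U(k, X₀)` and `Xs(k)` is at most `ε`. -/
def closeTimes (μ : Measure Ω) (W : ℕ → Ω → Vec m) (Xs : ℕ → Ω → Vec n) (N : ℕ)
    (X₀ : Ω → Vec n) (U : ℕ → Ω → Vec l) (ε : ℝ) : ℕ :=
  Set.ncard {k : ℕ | k < N ∧
    wasserstein 2 (μ.map (S.traj W X₀ U k)) (μ.map (Xs k)) ≤ ENNReal.ofReal ε}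

/-- The turnpike property in distribution at `(Xs, Us)`, where the number of times `k < N` at which
the distance exceeds `ε` is at most `(δ + C) / β ε`. The constant `C` depends on `X₀` only. -/
def TurnpikeInDistribution (μ : Measure Ω) (W : ℕ → Ω → Vec m) (Xs : ℕ → Ω → Vec n)
    (Us : ℕ → Ω → Vec l) (β : ℝ → ℝ) : Prop :=
  ∀ X₀ : Ω → Vec n, IsL2 μ X₀ →
    ∃ C : ℝ, ∀ δ : ℝ, 0 < δ → ∀ (N : ℕ) (U : ℕ → Ω → Vec l), S.IsControl μ W N X₀ U →
      S.totalCost μ W N X₀ U ≤ δ + ∑ k ∈ Finset.range N, S.stageCost μ (Xs k) (Us k) →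
      ∀ ε : ℝ, 0 < ε → (N : ℝ) - (δ + C) / β ε ≤ (S.closeTimes μ W Xs N X₀ U ε : ℝ)

end Problem

/-- The storage function
`λ(k, X) = E[‖X - (Xs(k) - x̃)‖²_{P + T} - ‖X - xs‖²_P + qᵀ (X - (Xs(k) - x̃))]`. -/
def storage (μ : Measure Ω) (P T : Matrix (Fin n) (Fin n) ℝ) (q xs xt : Vec n)
    (Xs : ℕ → Ω → Vec n) (k : ℕ) (X : Ω → Vec n) : ℝ :=
  ∫ ω, (quad (P + T) (X ω - (Xs k ω - xt)) - quad P (X ω - xs)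
    + inner ℝ q (X ω - (Xs k ω - xt))) ∂μ

/-- The probability space carries a uniformly distributed random variable that is independent of
the noise sequence. -/
def CarriesIndependentUniform (μ : Measure Ω) (W : ℕ → Ω → Vec m) : Prop :=
  ∃ ξ : Ω → ℝ, Measurable ξ ∧ μ.map ξ = volume.restrict (Set.Icc (0 : ℝ) 1) ∧
    IndepFun ξ (fun ω k => W k ω) μ

end StochLQ

end

namespace StochLQ

/-! ### Quadratic forms -/

section Quad

variable {a b d : ℕ}

/-! Everything rests on one dissipation inequality with the linear rate `c * r`. Let `y = Xs - xt -
xs` be the centred stationary state, and let `D = X - Xs + xt` and `V = U - Us + ut` be the shifted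
deviations. Since `Tr(Q₂ Cov X)` is the mean of a quadratic form minus that form at the mean, the
stage cost is quadratic with weights `Q₁ + Q₂` and `R₁ + R₂`, up to concave terms in the means.
Inserting the storage function, all products of `(D, V)` with `y` cancel pointwise by the Riccati
equation and its gain identity (`dissipation_pointwise`). The leftover terms in `y` and in the noise
have mean zero: by equality of laws, by centredness of `y`, or by independence of the noise.
Jensen's inequality absorbs the concave terms.

What survives is deterministic in `(D, V)`. Detectability supplies a form `T` for which `Q₁ + R₁`
plus the decrease of `T` is coercive (`IsDetectable.exists_storage`). Hence the linear-quadratic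
cost, restricted to pairs with `x = A x + B u`, has a minimizer `(xt, ut)`. Its Lagrange multiplier
`q` gives quadratic growth on the whole space (`optimal_steadyState_growth`). The matrix `P` is the
limit of value iteration started at zero (`IsStabilizable.exists_riccati`).

For the turnpike, the inequality is summed along a trajectory. The storage telescopes and is bounded
below, so the rates at the squared `L²` distances have bounded sum; since `W₂` is at most the `L²`
distance, each far time contributes at least `α (ε ^ 2)`.

For existence, `P + T` is a Lyapunov function of the closed loop, so a geometrically convergent
noise series has an invariant law. The uniform variable realizes this law as an initial state
independent of the noise. -/

theorem toEuclideanLin_mul_apply (A : Matrix (Fin a) (Fin b) ℝ) (B : Matrix (Fin b) (Fin d) ℝ)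
    (x : Vec d) : (A * B).toEuclideanLin x = A.toEuclideanLin (B.toEuclideanLin x) := by
  simp [Matrix.toLpLin_apply, Matrix.mulVec_mulVec]

theorem toEuclideanLin_one_apply (x : Vec d) :
    (1 : Matrix (Fin d) (Fin d) ℝ).toEuclideanLin x = x := by
  simp

theorem toEuclideanLin_add_apply (A B : Matrix (Fin a) (Fin b) ℝ) (x : Vec b) :
    (A + B).toEuclideanLin x = A.toEuclideanLin x + B.toEuclideanLin x := by
  simp

theorem toEuclideanLin_sub_apply (A B : Matrix (Fin a) (Fin b) ℝ) (x : Vec b) :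
    (A - B).toEuclideanLin x = A.toEuclideanLin x - B.toEuclideanLin x := by
  simp

theorem inner_transpose (A : Matrix (Fin a) (Fin b) ℝ) (x : Vec b) (y : Vec a) :
    inner ℝ x (Aᵀ.toEuclideanLin y) = inner ℝ (A.toEuclideanLin x) y := by
  rw [← Matrix.conjTranspose_eq_transpose_of_trivial,
    Matrix.toEuclideanLin_conjTranspose_eq_adjoint, LinearMap.adjoint_inner_right]

theorem inner_toEuclideanLin_comm {M : Matrix (Fin d) (Fin d) ℝ} (hM : M.IsHermitian)
    (x y : Vec d) : inner ℝ x (M.toEuclideanLin y) = inner ℝ y (M.toEuclideanLin x) := by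
  have h : Mᵀ = M := by rw [← Matrix.conjTranspose_eq_transpose_of_trivial]; exact hM
  conv_lhs => rw [← h, inner_transpose, real_inner_comm]

theorem quad_add_vec {M : Matrix (Fin d) (Fin d) ℝ} (hM : M.IsHermitian) (x y : Vec d) :
    quad M (x + y) = quad M x + 2 * inner ℝ x (M.toEuclideanLin y) + quad M y := by
  simp only [quad, map_add, inner_add_left, inner_add_right]
  rw [inner_toEuclideanLin_comm hM y x]
  ring

theorem quad_sub_vec {M : Matrix (Fin d) (Fin d) ℝ} (hM : M.IsHermitian) (x y : Vec d) :
    quad M (x - y) = quad M x - 2 * inner ℝ x (M.toEuclideanLin y) + quad M y := by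
  simp only [quad, map_sub, inner_sub_left, inner_sub_right]
  rw [inner_toEuclideanLin_comm hM y x]
  ring

theorem quad_add (M N : Matrix (Fin d) (Fin d) ℝ) (x : Vec d) :
    quad (M + N) x = quad M x + quad N x := by
  simp [quad, inner_add_right]

theorem quad_smul (r : ℝ) (M : Matrix (Fin d) (Fin d) ℝ) (x : Vec d) :
    quad (r • M) x = r * quad M x := by
  simp [quad, inner_smul_right]

theorem quad_smul_vec (r : ℝ) (M : Matrix (Fin d) (Fin d) ℝ) (x : Vec d) :
    quad M (r • x) = r ^ 2 * quad M x := by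
  simp only [quad, map_smul, inner_smul_left, inner_smul_right, RCLike.conj_to_real]
  ring

theorem quad_sum {ι : Type*} (s : Finset ι) (M : ι → Matrix (Fin d) (Fin d) ℝ) (x : Vec d) :
    quad (∑ i ∈ s, M i) x = ∑ i ∈ s, quad (M i) x := by
  simp [quad, inner_sum]

theorem quad_one (x : Vec d) : quad 1 x = ‖x‖ ^ 2 := by
  simp [quad]

theorem quad_transpose_mul_mul (M : Matrix (Fin a) (Fin a) ℝ) (A : Matrix (Fin a) (Fin d) ℝ)
    (x : Vec d) : quad (Aᵀ * M * A) x = quad M (A.toEuclideanLin x) := by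
  rw [quad, toEuclideanLin_mul_apply, toEuclideanLin_mul_apply, inner_transpose, quad]

theorem quad_eq_dotProduct (M : Matrix (Fin d) (Fin d) ℝ) (x : Vec d) :
    quad M x = star x.ofLp ⬝ᵥ (M *ᵥ x.ofLp) := by
  simp [quad, Matrix.toLpLin_apply, EuclideanSpace.inner_eq_star_dotProduct, dotProduct_comm]

theorem quad_nonneg {M : Matrix (Fin d) (Fin d) ℝ} (hM : M.PosSemidef) (x : Vec d) :
    0 ≤ quad M x := by
  rw [quad_eq_dotProduct]
  exact hM.dotProduct_mulVec_nonneg _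

theorem posSemidef_of_quad_nonneg {M : Matrix (Fin d) (Fin d) ℝ} (hM : M.IsHermitian)
    (h : ∀ x : Vec d, 0 ≤ quad M x) : M.PosSemidef := by
  refine Matrix.PosSemidef.of_dotProduct_mulVec_nonneg hM fun x => ?_
  have := h (WithLp.toLp 2 x)
  rwa [quad_eq_dotProduct] at this

theorem posDef_of_quad_pos {M : Matrix (Fin d) (Fin d) ℝ} (hM : M.IsHermitian)
    (h : ∀ x : Vec d, x ≠ 0 → 0 < quad M x) : M.PosDef := by
  refine Matrix.PosDef.of_dotProduct_mulVec_pos hM fun x hx => ?_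
  have := h (WithLp.toLp 2 x) (by simpa using hx)
  rwa [quad_eq_dotProduct] at this

theorem norm_toEuclideanLin_le (A : Matrix (Fin a) (Fin b) ℝ) :
    ∃ C : ℝ, 0 < C ∧ ∀ x : Vec b, ‖A.toEuclideanLin x‖ ≤ C * ‖x‖ := by
  obtain ⟨C, hC, h⟩ := A.toEuclideanLin.toContinuousLinearMap.bound
  exact ⟨C, hC, h⟩

theorem quad_le (M : Matrix (Fin d) (Fin d) ℝ) :
    ∃ C : ℝ, 0 < C ∧ ∀ x : Vec d, quad M x ≤ C * ‖x‖ ^ 2 := by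
  obtain ⟨C, hC, h⟩ := norm_toEuclideanLin_le M
  refine ⟨C, hC, fun x => (real_inner_le_norm _ _).trans ?_⟩
  nlinarith [h x, norm_nonneg x]

theorem continuous_quad (M : Matrix (Fin d) (Fin d) ℝ) : Continuous (quad M) := by
  have : Continuous fun x : Vec d => M.toEuclideanLin x :=
    M.toEuclideanLin.continuous_of_finiteDimensional
  exact continuous_id.inner this

theorem norm_sqrt_toEuclideanLin_sq {M : Matrix (Fin d) (Fin d) ℝ} (hM : M.PosSemidef)
    (x : Vec d) : ‖(CFC.sqrt M).toEuclideanLin x‖ ^ 2 = quad M x := by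
  have hs : CFC.sqrt M * CFC.sqrt M = M :=
    CFC.sqrt_mul_sqrt_self M (Matrix.nonneg_iff_posSemidef.2 hM)
  have hH : (CFC.sqrt M)ᵀ = CFC.sqrt M := by
    rw [← Matrix.conjTranspose_eq_transpose_of_trivial]
    exact (Matrix.nonneg_iff_posSemidef.1 (CFC.sqrt_nonneg M)).isHermitian
  rw [← quad_one, ← quad_transpose_mul_mul, mul_one, hH, hs]

theorem exists_le_quad {M : Matrix (Fin d) (Fin d) ℝ} (hM : M.PosDef) :
    ∃ c : ℝ, 0 < c ∧ ∀ x : Vec d, c * ‖x‖ ^ 2 ≤ quad M x := by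
  obtain ⟨C, hC, h⟩ := norm_toEuclideanLin_le (CFC.sqrt M)⁻¹
  have h0 : 0 ≤ M := Matrix.nonneg_iff_posSemidef.2 hM.posSemidef
  have hs : CFC.sqrt M * CFC.sqrt M = M := CFC.sqrt_mul_sqrt_self M h0
  have hu : IsUnit (CFC.sqrt M) := by
    have := hM.isUnit
    rw [← hs] at this
    exact isUnit_of_mul_isUnit_left this
  -- `C` bounds the inverse square root, so `‖x‖ ≤ C ‖√M x‖`, and `‖√M x‖ ^ 2` is the quadratic
  -- form.
  refine ⟨(C ^ 2)⁻¹, by positivity, fun x => ?_⟩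
  have h1 := h ((CFC.sqrt M).toEuclideanLin x)
  rw [← toEuclideanLin_mul_apply, Matrix.nonsing_inv_mul _ ((Matrix.isUnit_iff_isUnit_det _).1 hu),
    toEuclideanLin_one_apply] at h1
  rw [← norm_sqrt_toEuclideanLin_sq hM.posSemidef, inv_mul_le_iff₀ (by positivity), ← mul_pow]
  gcongr

/-- Young's inequality for a positive semidefinite form. -/
theorem quad_add_le {M : Matrix (Fin d) (Fin d) ℝ} (hM : M.PosSemidef) {η : ℝ} (hη : 0 < η)
    (x y : Vec d) : quad M (x + y) ≤ (1 + η) * quad M x + (1 + η⁻¹) * quad M y := by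
  have h := quad_nonneg hM (η • x - y)
  rw [quad_sub_vec hM.isHermitian, quad_smul_vec, inner_smul_left] at h
  simp only [RCLike.conj_to_real] at h
  rw [quad_add_vec hM.isHermitian]
  have h' := mul_nonneg (inv_nonneg.2 hη.le) h
  have e : η⁻¹ * (η ^ 2 * quad M x - 2 * (η * inner ℝ x (M.toEuclideanLin y)) + quad M y)
      = η * quad M x - 2 * inner ℝ x (M.toEuclideanLin y) + η⁻¹ * quad M y := by
    field_simp
  rw [e] at h'
  linarith

end Quad

/-! ### Lyapunov functions -/

section Lyapunov

variable {n l p : ℕ}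

-- Gelfand's formula over `ℂ`: the spectral radius is below one, so the powers are eventually
-- dominated by those of some `r < 1`. The choice of algebra norm is immaterial, since only entries
-- are kept.
attribute [local instance] Matrix.linftyOpNormedRing Matrix.linftyOpNormedAlgebra in
theorem IsSchurStable.tendsto_pow_apply {A : Matrix (Fin n) (Fin n) ℝ} (hA : IsSchurStable A)
    (i j : Fin n) : Filter.Tendsto (fun k : ℕ => (A ^ k) i j) Filter.atTop (nhds 0) := by
  have : Nonempty (Fin n) := ⟨i⟩
  set Ac : Matrix (Fin n) (Fin n) ℂ := A.map (algebraMap ℝ ℂ) with hAc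
  have h1 : spectralRadius ℂ Ac < ((1 : NNReal) : ℝ≥0∞) :=
    spectrum.spectralRadius_lt_of_forall_lt Ac fun ev hev => by
      have := hA ev hev
      exact_mod_cast this
  obtain ⟨r, hr1, hr2⟩ := ENNReal.lt_iff_exists_nnreal_btwn.1 h1
  have h2 := (spectrum.pow_nnnorm_pow_one_div_tendsto_nhds_spectralRadius Ac).eventually_lt_const
    hr1
  have h3 : Filter.Tendsto (fun k : ℕ => Ac ^ k) Filter.atTop (nhds 0) := by
    refine squeeze_zero_norm' (a := fun k : ℕ => (r : ℝ) ^ k) ?_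
      (tendsto_pow_atTop_nhds_zero_of_lt_one r.2 (by exact_mod_cast hr2))
    filter_upwards [h2, Filter.eventually_gt_atTop 0] with k hk hk0
    have hk' : (‖Ac ^ k‖₊ : ℝ≥0∞) ≤ (r : ℝ≥0∞) ^ k := by
      have h4 := ENNReal.rpow_le_rpow hk.le (Nat.cast_nonneg (α := ℝ) k)
      rwa [← ENNReal.rpow_mul, one_div, inv_mul_cancel₀ (by positivity), ENNReal.rpow_one,
        ENNReal.rpow_natCast] at h4
    exact_mod_cast hk'
  have h5 : Filter.Tendsto (fun k : ℕ => (Ac ^ k) i j) Filter.atTop (nhds 0) :=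
    ((tendsto_pi_nhds.1 ((tendsto_pi_nhds.1 h3) i)) j)
  have h6 : ∀ k : ℕ, (A ^ k) i j = ((Ac ^ k) i j).re := fun k => by
    have : Ac ^ k = (A ^ k).map (algebraMap ℝ ℂ) := by
      rw [hAc]
      exact (map_pow (algebraMap ℝ ℂ).mapMatrix A k).symm
    rw [this]
    simp
  simp only [h6]
  exact (Complex.continuous_re.tendsto 0).comp h5

theorem IsSchurStable.exists_pow_contraction {A : Matrix (Fin n) (Fin n) ℝ}
    (hA : IsSchurStable A) :
    ∃ N : ℕ, ∀ x : Vec n, ‖(A ^ N).toEuclideanLin x‖ ^ 2 ≤ 1 / 2 * ‖x‖ ^ 2 := by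
  have h1 : Filter.Tendsto (fun k : ℕ => ∑ i, ∑ j, ((A ^ k) i j) ^ 2) Filter.atTop
      (nhds (∑ i : Fin n, ∑ j : Fin n, (0 : ℝ) ^ 2)) := by
    refine tendsto_finsetSum _ fun i _ => tendsto_finsetSum _ fun j _ => ?_
    exact (hA.tendsto_pow_apply i j).pow 2
  have h2 := h1.eventually_le_const (u := 1 / 2) (by simp)
  obtain ⟨N, hN⟩ := h2.exists
  refine ⟨N, fun x => ?_⟩
  refine le_trans ?_ (mul_le_mul_of_nonneg_right hN (sq_nonneg ‖x‖))
  rw [EuclideanSpace.real_norm_sq_eq, Finset.sum_mul]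
  refine Finset.sum_le_sum fun i _ => ?_
  rw [EuclideanSpace.real_norm_sq_eq, Matrix.toLpLin_apply]
  exact Finset.sum_mul_sq_le_sq_mul_sq Finset.univ (fun j => (A ^ N) i j) (fun j => x j)

/-- A finite sum of `‖A ^ k x‖ ^ 2` suffices: passing from `x` to `A x` telescopes to `‖A ^ N x‖ ^ 2
- ‖x‖ ^ 2`, which is at most `-‖x‖ ^ 2 / 2` once `A ^ N` halves squared norms. -/
theorem IsSchurStable.exists_lyapunov {A : Matrix (Fin n) (Fin n) ℝ} (hA : IsSchurStable A) :
    ∃ T : Matrix (Fin n) (Fin n) ℝ, T.PosDef ∧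
      ∀ x : Vec n, quad T (A.toEuclideanLin x) + 1 / 2 * ‖x‖ ^ 2 ≤ quad T x := by
  obtain ⟨N, hN⟩ := hA.exists_pow_contraction
  set T₀ : Matrix (Fin n) (Fin n) ℝ := ∑ k ∈ Finset.range N, (A ^ k)ᵀ * 1 * A ^ k
  have hq : ∀ x, quad T₀ x = ∑ k ∈ Finset.range N, ‖(A ^ k).toEuclideanLin x‖ ^ 2 := fun x => by
    rw [quad_sum]
    exact Finset.sum_congr rfl fun k _ => by rw [quad_transpose_mul_mul, quad_one]
  have hL : ∀ x : Vec n, quad T₀ (A.toEuclideanLin x) + 1 / 2 * ‖x‖ ^ 2 ≤ quad T₀ x := fun x => by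
    have e : quad T₀ (A.toEuclideanLin x)
        = ∑ k ∈ Finset.range N, ‖(A ^ (k + 1)).toEuclideanLin x‖ ^ 2 := by
      rw [hq]
      exact Finset.sum_congr rfl fun k _ => by
        rw [pow_succ A, toEuclideanLin_mul_apply]
    have h1 := Finset.sum_range_succ (fun k => ‖(A ^ k).toEuclideanLin x‖ ^ 2) N
    have h2 := Finset.sum_range_succ' (fun k => ‖(A ^ k).toEuclideanLin x‖ ^ 2) N
    rw [pow_zero, toEuclideanLin_one_apply] at h2
    have h3 := hN x
    rw [e, hq]
    linarith
  have hT : T₀.IsHermitian := by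
    refine (Matrix.posSemidef_sum _ fun k _ => ?_).isHermitian
    rw [mul_one, ← Matrix.conjTranspose_eq_transpose_of_trivial]
    exact Matrix.posSemidef_conjTranspose_mul_self _
  have h0 : ∀ x, 0 ≤ quad T₀ x := fun x => by
    rw [hq]
    positivity
  refine ⟨T₀, posDef_of_quad_pos hT fun x hx => ?_, hL⟩
  have := hL x
  have := h0 (A.toEuclideanLin x)
  have : 0 < ‖x‖ ^ 2 := by positivity
  linarith

/-- Detectability yields a quadratic storage function that makes the stage cost strictly
dissipative. -/
theorem IsDetectable.exists_storage {A : Matrix (Fin n) (Fin n) ℝ} {Q : Matrix (Fin n) (Fin n) ℝ}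
    (B : Matrix (Fin n) (Fin l) ℝ) {R : Matrix (Fin l) (Fin l) ℝ} (hQ : Q.PosSemidef)
    (hR : R.PosDef) (hdet : IsDetectable A (CFC.sqrt Q)) :
    ∃ (T : Matrix (Fin n) (Fin n) ℝ) (c : ℝ), T.PosDef ∧ 0 < c ∧ ∀ (x : Vec n) (u : Vec l),
      c * (‖x‖ ^ 2 + ‖u‖ ^ 2) ≤ quad Q x + quad R u + quad T x
        - quad T (A.toEuclideanLin x + B.toEuclideanLin u) := by
  obtain ⟨L, hL⟩ := hdet
  obtain ⟨T, hT, hlyap⟩ := hL.exists_lyapunov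
  obtain ⟨t, ht, hTle⟩ := quad_le T
  obtain ⟨r, hr, hRle⟩ := exists_le_quad hR
  obtain ⟨b, hb, hBle⟩ := norm_toEuclideanLin_le B
  obtain ⟨g, hg, hLle⟩ := norm_toEuclideanLin_le L
  set M : ℝ := (1 + 4 * t) * (t * (2 * (b ^ 2 * r⁻¹ + g ^ 2))) with hM
  have hM0 : 0 < M := by positivity
  have key : ∀ (x : Vec n) (u : Vec l), quad T (A.toEuclideanLin x + B.toEuclideanLin u)
      ≤ quad T x - 1 / 4 * ‖x‖ ^ 2 + M * (quad Q x + quad R u) := by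
    intro x u
    set Cx := (CFC.sqrt Q).toEuclideanLin x with hCx
    have hC : ‖Cx‖ ^ 2 = quad Q x := norm_sqrt_toEuclideanLin_sq hQ x
    -- Output injection: the dynamics become those of the Schur stable matrix `A + L √Q` plus an
    -- error `w`, and `‖w‖ ^ 2` is controlled by `quad Q x + quad R u`.
    set w : Vec n := B.toEuclideanLin u - L.toEuclideanLin Cx
    have e : A.toEuclideanLin x + B.toEuclideanLin u
        = (A + L * CFC.sqrt Q).toEuclideanLin x + w := by
      rw [toEuclideanLin_add_apply, toEuclideanLin_mul_apply]
      simp only [w, hCx]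
      abel
    -- With this Young parameter the extra multiple of `T` costs at most `‖x‖ ^ 2 / 4`, half of the
    -- Lyapunov decrease.
    have hη : (0 : ℝ) < (4 * t)⁻¹ := by positivity
    have h1 := quad_add_le hT.posSemidef hη ((A + L * CFC.sqrt Q).toEuclideanLin x) w
    rw [← e, inv_inv] at h1
    have h2 := hlyap x
    have h3 := hTle x
    have h4 := hTle w
    have h5 : ‖w‖ ^ 2 ≤ 2 * (b ^ 2 * r⁻¹ + g ^ 2) * (quad Q x + quad R u) := by
      have hw : ‖w‖ ≤ b * ‖u‖ + g * ‖Cx‖ :=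
        (norm_sub_le _ _).trans (add_le_add (hBle u) (hLle Cx))
      have hw2 : ‖w‖ ^ 2 ≤ 2 * (b ^ 2 * ‖u‖ ^ 2 + g ^ 2 * ‖Cx‖ ^ 2) := by
        have := pow_le_pow_left₀ (norm_nonneg w) hw 2
        nlinarith [sq_nonneg (b * ‖u‖ - g * ‖Cx‖)]
      have hu : ‖u‖ ^ 2 ≤ r⁻¹ * quad R u := by
        rw [le_inv_mul_iff₀ hr]
        exact hRle u
      have hu' : b ^ 2 * ‖u‖ ^ 2 ≤ b ^ 2 * r⁻¹ * quad R u := by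
        rw [mul_assoc]
        gcongr
      have hQ0 := quad_nonneg hQ x
      have hR0 := quad_nonneg hR.posSemidef u
      rw [hC] at hw2
      have : 0 ≤ b ^ 2 * r⁻¹ * quad Q x := by positivity
      have : 0 ≤ g ^ 2 * quad R u := by positivity
      linarith
    have h6 : (4 * t)⁻¹ * quad T ((A + L * CFC.sqrt Q).toEuclideanLin x) ≤ 1 / 4 * ‖x‖ ^ 2 := by
      rw [inv_mul_le_iff₀ (by positivity)]
      have : 0 ≤ ‖x‖ ^ 2 := by positivity
      linarith
    have h7 : (1 + 4 * t) * quad T w ≤ M * (quad Q x + quad R u) := by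
      rw [hM, mul_assoc]
      refine mul_le_mul_of_nonneg_left (h4.trans ?_) (by positivity)
      rw [mul_assoc]
      exact mul_le_mul_of_nonneg_left h5 ht.le
    linarith
  -- After scaling, the error term consumes only half of `quad Q x + quad R u`; the remaining half
  -- of `R` controls `u`.
  refine ⟨(2 * M)⁻¹ • T, min (1 / 4 * (2 * M)⁻¹) (r / 2), hT.smul (by positivity),
    lt_min (by positivity) (by positivity), fun x u => ?_⟩
  rw [quad_smul, quad_smul]
  have h1 := mul_le_mul_of_nonneg_left (key x u) (show 0 ≤ (2 * M)⁻¹ by positivity)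
  have e : (2 * M)⁻¹ * (quad T x - 1 / 4 * ‖x‖ ^ 2 + M * (quad Q x + quad R u))
      = (2 * M)⁻¹ * quad T x - 1 / 4 * (2 * M)⁻¹ * ‖x‖ ^ 2 + 1 / 2 * (quad Q x + quad R u) := by
    field_simp
  rw [e] at h1
  have h2 : min (1 / 4 * (2 * M)⁻¹) (r / 2) * ‖x‖ ^ 2 ≤ 1 / 4 * (2 * M)⁻¹ * ‖x‖ ^ 2 :=
    mul_le_mul_of_nonneg_right (min_le_left _ _) (sq_nonneg _)
  have h3 : min (1 / 4 * (2 * M)⁻¹) (r / 2) * ‖u‖ ^ 2 ≤ r / 2 * ‖u‖ ^ 2 :=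
    mul_le_mul_of_nonneg_right (min_le_right _ _) (sq_nonneg _)
  have h4 := hRle u
  have h5 := quad_nonneg hQ x
  linarith

end Lyapunov

/-! ### The discrete-time algebraic Riccati equation -/

section Riccati

variable {n l : ℕ}

/-- For `R = R₁ + R₂` this unfolds to `Problem.gain`, so the results below apply to it by
definitional equality. -/
noncomputable def riccatiGain (A : Matrix (Fin n) (Fin n) ℝ) (B : Matrix (Fin n) (Fin l) ℝ)
    (R : Matrix (Fin l) (Fin l) ℝ) (P : Matrix (Fin n) (Fin n) ℝ) : Matrix (Fin l) (Fin n) ℝ :=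
  -((R + Bᵀ * P * B)⁻¹ * Bᵀ * P * A)

/-- The right-hand side of the discrete-time algebraic Riccati equation. -/
noncomputable def riccatiMap (A : Matrix (Fin n) (Fin n) ℝ) (B : Matrix (Fin n) (Fin l) ℝ)
    (Q : Matrix (Fin n) (Fin n) ℝ) (R : Matrix (Fin l) (Fin l) ℝ) (P : Matrix (Fin n) (Fin n) ℝ) :
    Matrix (Fin n) (Fin n) ℝ :=
  Aᵀ * P * A + Q - Aᵀ * P * B * (R + Bᵀ * P * B)⁻¹ * Bᵀ * P * A

variable {A : Matrix (Fin n) (Fin n) ℝ} {B : Matrix (Fin n) (Fin l) ℝ}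
  {Q : Matrix (Fin n) (Fin n) ℝ} {R : Matrix (Fin l) (Fin l) ℝ} {P : Matrix (Fin n) (Fin n) ℝ}

theorem posDef_add_transpose_mul_mul (hR : R.PosDef) (hP : P.PosSemidef)
    (B : Matrix (Fin n) (Fin l) ℝ) : (R + Bᵀ * P * B).PosDef := by
  refine hR.add_posSemidef ?_
  have := hP.conjTranspose_mul_mul_same B
  rwa [Matrix.conjTranspose_eq_transpose_of_trivial] at this

/-- First-order condition for minimizing `quad R u + quad P (A x + B u)` in `u`. It kills the cross
terms both in the completion of the square and in the dissipation identity. -/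
theorem riccatiGain_eq (hR : R.PosDef) (hP : P.PosSemidef) :
    R * riccatiGain A B R P + Bᵀ * P * (A + B * riccatiGain A B R P) = 0 := by
  have hu := (Matrix.isUnit_iff_isUnit_det _).1 (posDef_add_transpose_mul_mul hR hP B).isUnit
  have h : (R + Bᵀ * P * B) * riccatiGain A B R P = -(Bᵀ * P * A) := by
    rw [riccatiGain, Matrix.mul_neg, Matrix.mul_assoc _ Bᵀ, Matrix.mul_assoc _ (Bᵀ * P),
      Matrix.mul_nonsing_inv_cancel_left _ _ hu]
  calc R * riccatiGain A B R P + Bᵀ * P * (A + B * riccatiGain A B R P)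
      = (R + Bᵀ * P * B) * riccatiGain A B R P + Bᵀ * P * A := by
        simp only [Matrix.mul_add, Matrix.add_mul, Matrix.mul_assoc]
        abel
    _ = 0 := by rw [h, neg_add_cancel]

theorem riccatiMap_eq : riccatiMap A B Q R P = Aᵀ * P * (A + B * riccatiGain A B R P) + Q := by
  simp only [riccatiMap, riccatiGain, Matrix.mul_add, Matrix.mul_neg, Matrix.mul_assoc]
  abel

/-- The two sides differ by `Kᵀ` times the first-order condition. This form exhibits positivity and
the one-step cost under the feedback. -/
theorem riccatiMap_eq_closedLoop (hR : R.PosDef) (hP : P.PosSemidef) :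
    riccatiMap A B Q R P = (A + B * riccatiGain A B R P)ᵀ * P * (A + B * riccatiGain A B R P)
      + (riccatiGain A B R P)ᵀ * R * riccatiGain A B R P + Q := by
  have h := congrArg (fun M => (riccatiGain A B R P)ᵀ * M) (riccatiGain_eq (A := A) (B := B) hR hP)
  simp only [Matrix.mul_add, Matrix.mul_zero] at h
  rw [riccatiMap_eq]
  simp only [Matrix.transpose_add, Matrix.transpose_mul, Matrix.mul_add, Matrix.add_mul,
    Matrix.mul_assoc] at h ⊢
  rw [← sub_eq_zero, ← neg_eq_zero, ← h]
  abel

theorem posSemidef_riccatiMap (hQ : Q.PosSemidef) (hR : R.PosDef) (hP : P.PosSemidef) :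
    (riccatiMap A B Q R P).PosSemidef := by
  rw [riccatiMap_eq_closedLoop hR hP]
  have h1 := hP.conjTranspose_mul_mul_same (A + B * riccatiGain A B R P)
  have h2 := hR.posSemidef.conjTranspose_mul_mul_same (riccatiGain A B R P)
  rw [Matrix.conjTranspose_eq_transpose_of_trivial] at h1 h2
  exact (h1.add h2).add hQ

theorem quad_riccatiMap (hR : R.PosDef) (hP : P.PosSemidef) (x : Vec n) :
    quad (riccatiMap A B Q R P) x = quad Q x + quad R ((riccatiGain A B R P).toEuclideanLin x)
      + quad P ((A + B * riccatiGain A B R P).toEuclideanLin x) := by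
  rw [riccatiMap_eq_closedLoop hR hP, quad_add, quad_add, quad_transpose_mul_mul,
    quad_transpose_mul_mul]
  ring

/-- The feedback `riccatiGain` minimizes the one-step cost with terminal cost `P`. -/
theorem quad_riccatiMap_le (hR : R.PosDef) (hP : P.PosSemidef) (x : Vec n) (u : Vec l) :
    quad (riccatiMap A B Q R P) x
      ≤ quad Q x + quad R u + quad P (A.toEuclideanLin x + B.toEuclideanLin u) := by
  rw [quad_riccatiMap hR hP]
  set K := riccatiGain A B R P with hK
  -- Completion of the square around the minimizer: the terms linear in `w` vanish by
  -- `riccatiGain_eq`.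
  obtain ⟨w, rfl⟩ : ∃ w, u = K.toEuclideanLin x + w := ⟨u - K.toEuclideanLin x, by abel⟩
  have e : A.toEuclideanLin x + B.toEuclideanLin (K.toEuclideanLin x + w)
      = (A + B * K).toEuclideanLin x + B.toEuclideanLin w := by
    rw [toEuclideanLin_add_apply, toEuclideanLin_mul_apply, map_add]
    abel
  have h0 : inner ℝ w ((R * K + Bᵀ * P * (A + B * K)).toEuclideanLin x) = 0 := by
    rw [hK, riccatiGain_eq hR hP]
    simp
  rw [toEuclideanLin_add_apply, inner_add_right, toEuclideanLin_mul_apply,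
    toEuclideanLin_mul_apply, toEuclideanLin_mul_apply, inner_transpose] at h0
  rw [e, quad_add_vec hR.isHermitian, quad_add_vec hP.isHermitian,
    inner_toEuclideanLin_comm hR.isHermitian _ w,
    inner_toEuclideanLin_comm hP.isHermitian _ (B.toEuclideanLin w)]
  have h1 := quad_nonneg hR.posSemidef w
  have h2 := quad_nonneg hP (B.toEuclideanLin w)
  linarith

theorem matrix_apply_eq_inner (M : Matrix (Fin n) (Fin n) ℝ) (i j : Fin n) :
    M i j = inner ℝ (EuclideanSpace.single i 1) (M.toEuclideanLin (EuclideanSpace.single j 1)) := by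
  simp [EuclideanSpace.inner_single_left, Matrix.toLpLin_apply]

theorem matrix_apply_eq_quad {M : Matrix (Fin n) (Fin n) ℝ} (hM : M.IsHermitian) (i j : Fin n) :
    M i j = (quad M (EuclideanSpace.single i 1 + EuclideanSpace.single j 1)
      - quad M (EuclideanSpace.single i 1) - quad M (EuclideanSpace.single j 1)) / 2 := by
  rw [matrix_apply_eq_inner M, quad_add_vec hM]
  ring

theorem continuous_quad_matrix (x : Vec n) :
    Continuous fun M : Matrix (Fin n) (Fin n) ℝ => quad M x := by
  simp only [quad_eq_dotProduct]
  fun_prop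

/-- A nondecreasing bounded sequence of symmetric matrices converges. -/
theorem exists_tendsto_of_monotone_quad {M : ℕ → Matrix (Fin n) (Fin n) ℝ}
    (hM : ∀ k, (M k).PosSemidef) (hmono : ∀ x, Monotone fun k => quad (M k) x)
    (X : Matrix (Fin n) (Fin n) ℝ) (hX : ∀ k x, quad (M k) x ≤ quad X x) :
    ∃ P : Matrix (Fin n) (Fin n) ℝ, P.PosSemidef ∧
      Filter.Tendsto M Filter.atTop (nhds P) := by
  have hlim : ∀ x, ∃ t, Filter.Tendsto (fun k => quad (M k) x) Filter.atTop (nhds t) := fun x =>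
    ⟨_, tendsto_atTop_ciSup (hmono x) ⟨quad X x, by rintro _ ⟨k, rfl⟩; exact hX k x⟩⟩
  choose t ht using hlim
  -- Polarization recovers each entry of the limit from the limits of the quadratic forms.
  set P : Matrix (Fin n) (Fin n) ℝ := Matrix.of fun i j =>
    (t (EuclideanSpace.single i 1 + EuclideanSpace.single j 1)
      - t (EuclideanSpace.single i 1) - t (EuclideanSpace.single j 1)) / 2
  have hP : Filter.Tendsto M Filter.atTop (nhds P) := by
    refine tendsto_pi_nhds.2 fun i => tendsto_pi_nhds.2 fun j => ?_
    simp only [fun k => matrix_apply_eq_quad (hM k).isHermitian i j]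
    exact (((ht _).sub (ht _)).sub (ht _)).div_const 2
  refine ⟨P, posSemidef_of_quad_nonneg ?_ fun x => ?_, hP⟩
  · refine Matrix.IsHermitian.ext fun i j => ?_
    simp only [P, Matrix.of_apply, star_trivial,
      add_comm (EuclideanSpace.single i (1 : ℝ)) (EuclideanSpace.single j 1)]
    ring
  · exact ge_of_tendsto' (((continuous_quad_matrix x).tendsto P).comp hP)
      fun k => quad_nonneg (hM k) x

theorem continuousAt_add_transpose_mul_mul_inv (hR : R.PosDef) (hP : P.PosSemidef) :
    ContinuousAt (fun P : Matrix (Fin n) (Fin n) ℝ => (R + Bᵀ * P * B)⁻¹) P := by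
  have hc : Continuous fun P : Matrix (Fin n) (Fin n) ℝ => R + Bᵀ * P * B := by fun_prop
  have hdet : (R + Bᵀ * P * B).det ≠ 0 :=
    ((Matrix.isUnit_iff_isUnit_det _).1 (posDef_add_transpose_mul_mul hR hP B).isUnit).ne_zero
  have hd : ContinuousAt (fun P : Matrix (Fin n) (Fin n) ℝ => (R + Bᵀ * P * B).det⁻¹) P :=
    hc.matrix_det.continuousAt.inv₀ hdet
  have ha : ContinuousAt (fun P : Matrix (Fin n) (Fin n) ℝ => (R + Bᵀ * P * B).adjugate) P :=
    hc.matrix_adjugate.continuousAt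
  have he : (fun P : Matrix (Fin n) (Fin n) ℝ => (R + Bᵀ * P * B)⁻¹)
      = fun P => (R + Bᵀ * P * B).det⁻¹ • (R + Bᵀ * P * B).adjugate := by
    funext P
    rw [Matrix.inv_def, Ring.inverse_eq_inv']
  rw [he]
  exact hd.smul ha

theorem continuousAt_riccatiMap (hR : R.PosDef) (hP : P.PosSemidef) :
    ContinuousAt (riccatiMap A B Q R) P := by
  have hF : Continuous fun p : Matrix (Fin n) (Fin n) ℝ × Matrix (Fin l) (Fin l) ℝ =>
      Aᵀ * p.1 * A + Q - Aᵀ * p.1 * B * p.2 * Bᵀ * p.1 * A := by fun_prop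
  have hp : ContinuousAt (fun P : Matrix (Fin n) (Fin n) ℝ => (P, (R + Bᵀ * P * B)⁻¹)) P :=
    continuousAt_id.prodMk (continuousAt_add_transpose_mul_mul_inv hR hP)
  have h := hF.continuousAt.comp' hp
  have e : riccatiMap A B Q R
      = fun P => Aᵀ * P * A + Q - Aᵀ * P * B * (R + Bᵀ * P * B)⁻¹ * Bᵀ * P * A := rfl
  rw [e]
  exact h

/-- The Riccati equation has a positive semidefinite solution if `(A, B)` is stabilizable. -/
theorem IsStabilizable.exists_riccati (hstab : IsStabilizable A B) (hQ : Q.PosSemidef)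
    (hR : R.PosDef) : ∃ P : Matrix (Fin n) (Fin n) ℝ, P.PosSemidef ∧ P = riccatiMap A B Q R P := by
  obtain ⟨F, hF⟩ := hstab
  obtain ⟨T, hT, hlyap⟩ := hF.exists_lyapunov
  obtain ⟨t, ht, hle⟩ := quad_le (Q + Fᵀ * R * F)
  -- The factor `2 * t` makes the decrease of `X` under the stabilizing feedback pay for its stage
  -- cost, so `X` dominates every value iterate.
  set X : Matrix (Fin n) (Fin n) ℝ := (2 * t) • T with hX
  have hXle : ∀ x, quad Q x + quad R (F.toEuclideanLin x)
      + quad X ((A + B * F).toEuclideanLin x) ≤ quad X x := fun x => by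
    have h1 := hle x
    rw [quad_add, quad_transpose_mul_mul] at h1
    have h2 := mul_le_mul_of_nonneg_left (hlyap x) (show 0 ≤ 2 * t by positivity)
    rw [hX, quad_smul, quad_smul]
    linarith
  set M : ℕ → Matrix (Fin n) (Fin n) ℝ := fun k => (riccatiMap A B Q R)^[k] 0 with hMdef
  have hsucc : ∀ k, M (k + 1) = riccatiMap A B Q R (M k) := fun k => by
    rw [hMdef]
    exact Function.iterate_succ_apply' _ _ _
  have hM : ∀ k, (M k).PosSemidef := fun k => by
    induction k with
    | zero => exact Matrix.PosSemidef.zero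
    | succ k ih => rw [hsucc]; exact posSemidef_riccatiMap hQ hR ih
  have hM0 : ∀ x, quad (M 0) x = 0 := fun x => by simp [M, quad]
  have hmono : ∀ k x, quad (M k) x ≤ quad (M (k + 1)) x := fun k => by
    induction k with
    | zero => intro x; rw [hM0]; exact quad_nonneg (hM _) x
    | succ k ih =>
      intro x
      rw [hsucc (k + 1), quad_riccatiMap hR (hM _)]
      -- The minimizing feedback for the later iterate is merely admissible for the earlier one.
      nth_rewrite 1 [hsucc k]
      refine (quad_riccatiMap_le hR (hM k) x
        ((riccatiGain A B R (M (k + 1))).toEuclideanLin x)).trans ?_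
      rw [← toEuclideanLin_mul_apply, ← toEuclideanLin_add_apply]
      exact add_le_add le_rfl (ih _)
  have hbdd : ∀ k x, quad (M k) x ≤ quad X x := fun k => by
    induction k with
    | zero => intro x; rw [hM0, hX, quad_smul]; have := quad_nonneg hT.posSemidef x; positivity
    | succ k ih =>
      intro x
      rw [hsucc]
      refine (quad_riccatiMap_le hR (hM k) x (F.toEuclideanLin x)).trans ?_
      refine le_trans ?_ (hXle x)
      rw [← toEuclideanLin_mul_apply, ← toEuclideanLin_add_apply]
      exact add_le_add le_rfl (ih _)
  obtain ⟨P, hP, hlim⟩ := exists_tendsto_of_monotone_quad hM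
    (fun x => monotone_nat_of_le_succ fun k => hmono k x) X hbdd
  refine ⟨P, hP, tendsto_nhds_unique ((Filter.tendsto_add_atTop_iff_nat 1).2 hlim) ?_⟩
  simp only [hsucc]
  exact (continuousAt_riccatiMap hR hP).tendsto.comp hlim

end Riccati

/-! ### Optimal steady states and Lagrange multipliers -/

/-- Minimizers of a coercive quadratic function on the kernel of a linear map exist and have a
Lagrange multiplier. -/
theorem exists_lagrange_multiplier {E F : Type*} [NormedAddCommGroup E] [InnerProductSpace ℝ E]
    [FiniteDimensional ℝ E] [NormedAddCommGroup F] [InnerProductSpace ℝ F] [FiniteDimensional ℝ F]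
    (H : E →ₗ[ℝ] E) (G : E →ₗ[ℝ] F) (hH : ∀ x, x ≠ 0 → 0 < inner ℝ x (H x)) (b : E) :
    ∃ w q, G w = 0 ∧ H w + b + LinearMap.adjoint G q = 0 := by
  set N := LinearMap.ker G
  -- The compression of `H` to the kernel is injective by positivity, hence bijective. Solving there
  -- leaves a residual orthogonal to the kernel, that is, in the range of the adjoint.
  set C : N →ₗ[ℝ] N := N.orthogonalProjectionOnto.toLinearMap ∘ₗ H ∘ₗ N.subtype with hC
  have hCapp : ∀ w : N, C w = N.orthogonalProjectionOnto (H w) := fun w => rfl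
  have hinj : Function.Injective C := by
    rw [← LinearMap.ker_eq_bot, LinearMap.ker_eq_bot']
    intro w hw
    by_contra hne
    have h1 := hH w (by simpa using hne)
    have h2 : inner ℝ (w : E) (H w) = inner ℝ w (C w) := by
      rw [hCapp, Submodule.coe_inner, Submodule.coe_orthogonalProjectionOnto_apply,
        ← Submodule.inner_starProjection_left_eq_right, Submodule.starProjection_eq_self_iff.2 w.2]
    rw [h2, hw, inner_zero_right] at h1
    exact h1.false
  obtain ⟨w, hw⟩ := LinearMap.injective_iff_surjective.1 hinj (-N.orthogonalProjectionOnto b)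
  have h3 : H w + b ∈ Nᗮ := by
    rw [← Submodule.orthogonalProjectionOnto_eq_zero_iff, map_add, ← hCapp, hw, neg_add_cancel]
  rw [LinearMap.orthogonal_ker] at h3
  obtain ⟨q, hq⟩ := h3
  exact ⟨w, -q, w.2, by rw [map_neg, hq, add_neg_cancel]⟩

section SteadyState

variable {n l : ℕ} {A : Matrix (Fin n) (Fin n) ℝ} {B : Matrix (Fin n) (Fin l) ℝ}
  {Q T : Matrix (Fin n) (Fin n) ℝ} {R : Matrix (Fin l) (Fin l) ℝ}

/-- Optimality conditions for the optimal steady state problem with the linear cost `(a, b)`. -/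
theorem exists_optimal_steadyState {c : ℝ} (hc : 0 < c)
    (hcoer : ∀ (x : Vec n) (u : Vec l), c * (‖x‖ ^ 2 + ‖u‖ ^ 2) ≤ quad Q x + quad R u + quad T x
        - quad T (A.toEuclideanLin x + B.toEuclideanLin u)) (a : Vec n) (b : Vec l) :
    ∃ (xt : Vec n) (ut : Vec l) (q : Vec n),
      (1 - A).toEuclideanLin xt - B.toEuclideanLin ut = 0 ∧ ∀ (x : Vec n) (u : Vec l),
        2 * (inner ℝ x (Q.toEuclideanLin xt) + inner ℝ u (R.toEuclideanLin ut)
          + inner ℝ x (T.toEuclideanLin xt)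
          - inner ℝ (A.toEuclideanLin x + B.toEuclideanLin u)
              (T.toEuclideanLin (A.toEuclideanLin xt + B.toEuclideanLin ut)))
        + inner ℝ a x + inner ℝ b u
        + inner ℝ q (x - (A.toEuclideanLin x + B.toEuclideanLin u)) = 0 := by
  set p₁ : WithLp 2 (Vec n × Vec l) →ₗ[ℝ] Vec n :=
    LinearMap.fst ℝ _ _ ∘ₗ (WithLp.linearEquiv 2 ℝ (Vec n × Vec l)).toLinearMap
  set p₂ : WithLp 2 (Vec n × Vec l) →ₗ[ℝ] Vec l :=
    LinearMap.snd ℝ _ _ ∘ₗ (WithLp.linearEquiv 2 ℝ (Vec n × Vec l)).toLinearMap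
  set J : WithLp 2 (Vec n × Vec l) →ₗ[ℝ] Vec n :=
    A.toEuclideanLin ∘ₗ p₁ + B.toEuclideanLin ∘ₗ p₂
  set H : WithLp 2 (Vec n × Vec l) →ₗ[ℝ] WithLp 2 (Vec n × Vec l) :=
    LinearMap.adjoint p₁ ∘ₗ (Q + T).toEuclideanLin ∘ₗ p₁
      + LinearMap.adjoint p₂ ∘ₗ R.toEuclideanLin ∘ₗ p₂
      - LinearMap.adjoint J ∘ₗ T.toEuclideanLin ∘ₗ J
  have hHapp : ∀ w w', inner ℝ w (H w') = inner ℝ (p₁ w) (Q.toEuclideanLin (p₁ w'))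
      + inner ℝ (p₁ w) (T.toEuclideanLin (p₁ w')) + inner ℝ (p₂ w) (R.toEuclideanLin (p₂ w'))
      - inner ℝ (J w) (T.toEuclideanLin (J w')) := fun w w' => by
    simp only [H, LinearMap.sub_apply, LinearMap.add_apply, LinearMap.comp_apply, inner_sub_right,
      inner_add_right, LinearMap.adjoint_inner_right, map_add]
  have hpos : ∀ w, w ≠ 0 → 0 < inner ℝ w (H w) := fun w hw => by
    have h1 := hcoer (p₁ w) (p₂ w)
    have h2 : ‖p₁ w‖ ^ 2 + ‖p₂ w‖ ^ 2 = ‖w‖ ^ 2 := (WithLp.prod_norm_sq_eq_of_L2 w).symm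
    rw [h2] at h1
    have h3 : 0 < ‖w‖ ^ 2 := by positivity
    have h4 : 0 < c * ‖w‖ ^ 2 := by positivity
    rw [hHapp]
    simp only [quad] at h1
    have h5 : J w = A.toEuclideanLin (p₁ w) + B.toEuclideanLin (p₂ w) := rfl
    rw [h5]
    linarith
  obtain ⟨w, q, hw, hq⟩ := exists_lagrange_multiplier H (p₁ - J) hpos
    -- The gradient of the quadratic part is `2 H`; halving the linear cost matches the unscaled
    -- equation, and the multiplier is doubled afterwards.
    (WithLp.toLp 2 ((1 / 2 : ℝ) • a, (1 / 2 : ℝ) • b))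
  refine ⟨p₁ w, p₂ w, (2 : ℝ) • q, ?_, fun x u => ?_⟩
  · rw [← hw, toEuclideanLin_sub_apply, toEuclideanLin_one_apply]
    simp only [J, LinearMap.sub_apply, LinearMap.add_apply, LinearMap.comp_apply]
    abel
  · have h1 := congrArg (fun z => inner ℝ (WithLp.toLp 2 (x, u)) z) hq
    simp only [inner_add_right, inner_zero_right, LinearMap.adjoint_inner_right, hHapp,
      WithLp.prod_inner_apply, LinearMap.sub_apply, inner_smul_right] at h1
    have e1 : p₁ (WithLp.toLp 2 (x, u)) = x := rfl
    have e2 : p₂ (WithLp.toLp 2 (x, u)) = u := rfl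
    have e3 : J (WithLp.toLp 2 (x, u)) = A.toEuclideanLin x + B.toEuclideanLin u := rfl
    have e4 : J w = A.toEuclideanLin (p₁ w) + B.toEuclideanLin (p₂ w) := rfl
    rw [e1, e2, e3, e4, real_inner_comm a x, real_inner_comm b u] at h1
    rw [inner_smul_left, real_inner_comm _ q]
    simp only [RCLike.conj_to_real]
    linarith

/-- The cost with Lagrange multiplier grows quadratically around the optimal steady state. -/
theorem optimal_steadyState_growth (hQ : Q.IsHermitian) (hR : R.IsHermitian) (hT : T.IsHermitian)
    {c : ℝ} (hcoer : ∀ (x : Vec n) (u : Vec l),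
      c * (‖x‖ ^ 2 + ‖u‖ ^ 2) ≤ quad Q x + quad R u + quad T x
        - quad T (A.toEuclideanLin x + B.toEuclideanLin u)) {a : Vec n} {b : Vec l}
    {xt : Vec n} {ut : Vec l} {q : Vec n}
    (hsteady : A.toEuclideanLin xt + B.toEuclideanLin ut = xt)
    (hopt : ∀ (x : Vec n) (u : Vec l),
        2 * (inner ℝ x (Q.toEuclideanLin xt) + inner ℝ u (R.toEuclideanLin ut)
          + inner ℝ x (T.toEuclideanLin xt)
          - inner ℝ (A.toEuclideanLin x + B.toEuclideanLin u)
              (T.toEuclideanLin (A.toEuclideanLin xt + B.toEuclideanLin ut)))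
        + inner ℝ a x + inner ℝ b u
        + inner ℝ q (x - (A.toEuclideanLin x + B.toEuclideanLin u)) = 0) (x : Vec n) (u : Vec l) :
    c * (‖x - xt‖ ^ 2 + ‖u - ut‖ ^ 2) ≤ quad Q x + quad R u + quad T x
        - quad T (A.toEuclideanLin x + B.toEuclideanLin u)
        + inner ℝ a (x - xt) + inner ℝ b (u - ut)
        + inner ℝ q (x - (A.toEuclideanLin x + B.toEuclideanLin u)) - quad Q xt - quad R ut := by
  obtain ⟨y, rfl⟩ : ∃ y, x = y + xt := ⟨x - xt, by abel⟩
  obtain ⟨w, rfl⟩ : ∃ w, u = w + ut := ⟨u - ut, by abel⟩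
  have e : A.toEuclideanLin (y + xt) + B.toEuclideanLin (w + ut)
      = A.toEuclideanLin y + B.toEuclideanLin w + xt := by
    conv_rhs => rw [← hsteady]
    simp only [map_add]
    abel
  have h1 := hcoer y w
  have h2 := hopt y w
  rw [hsteady] at h2
  rw [e, add_sub_add_right_eq_sub, quad_add_vec hQ, quad_add_vec hR, quad_add_vec hT y,
    quad_add_vec hT (_ + _), add_sub_cancel_right, add_sub_cancel_right]
  linarith

end SteadyState

/-! ### Stability of the Riccati closed loop -/

section ClosedLoop

variable {n l : ℕ} {A : Matrix (Fin n) (Fin n) ℝ} {B : Matrix (Fin n) (Fin l) ℝ}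
  {Q₁ Q₂ T P : Matrix (Fin n) (Fin n) ℝ} {R₁ R₂ : Matrix (Fin l) (Fin l) ℝ}

/-- A Lyapunov function of the closed loop with the Riccati gain. -/
theorem closedLoop_lyapunov {c : ℝ} (hc : 0 < c) (hcoer : ∀ (x : Vec n) (u : Vec l),
      c * (‖x‖ ^ 2 + ‖u‖ ^ 2) ≤ quad Q₁ x + quad R₁ u + quad T x
        - quad T (A.toEuclideanLin x + B.toEuclideanLin u))
    (hQ₂ : Q₂.PosSemidef) (hR₁ : R₁.PosDef) (hR₂ : R₂.PosSemidef) (hP : P.PosSemidef)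
    (hric : P = riccatiMap A B (Q₁ + Q₂) (R₁ + R₂) P) (x : Vec n) :
    quad (P + T) ((A + B * riccatiGain A B (R₁ + R₂) P).toEuclideanLin x) + c * ‖x‖ ^ 2
      ≤ quad (P + T) x := by
  have h1 := quad_riccatiMap (A := A) (B := B) (Q := Q₁ + Q₂) (hR₁.add_posSemidef hR₂) hP x
  rw [← hric] at h1
  set u := (riccatiGain A B (R₁ + R₂) P).toEuclideanLin x with hu
  have h2 := hcoer x u
  have e : A.toEuclideanLin x + B.toEuclideanLin u
      = (A + B * riccatiGain A B (R₁ + R₂) P).toEuclideanLin x := by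
    rw [toEuclideanLin_add_apply, toEuclideanLin_mul_apply]
  rw [e] at h2
  rw [quad_add, quad_add]
  rw [quad_add, quad_add] at h1
  have h3 := quad_nonneg hQ₂ x
  have h4 := quad_nonneg hR₂ u
  have h5 : 0 ≤ c * ‖u‖ ^ 2 := by positivity
  linarith

end ClosedLoop

/-! ### Expectations -/

section Expectation

variable {Ω : Type*} [MeasurableSpace Ω] {μ : Measure Ω}

/-- The random variable `f` is integrable with expectation `a`. -/
structure HasExp (μ : Measure Ω) (f : Ω → ℝ) (a : ℝ) : Prop where
  integrable : Integrable f μ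
  integral_eq : ∫ ω, f ω ∂μ = a

theorem _root_.MeasureTheory.Integrable.hasExp {f : Ω → ℝ} (hf : Integrable f μ) :
    HasExp μ f (∫ ω, f ω ∂μ) :=
  ⟨hf, rfl⟩

theorem HasExp.add {f g : Ω → ℝ} {a b : ℝ} (hf : HasExp μ f a) (hg : HasExp μ g b) :
    HasExp μ (fun ω => f ω + g ω) (a + b) :=
  ⟨hf.1.add hg.1, by rw [integral_add hf.1 hg.1, hf.2, hg.2]⟩

theorem HasExp.sub {f g : Ω → ℝ} {a b : ℝ} (hf : HasExp μ f a) (hg : HasExp μ g b) :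
    HasExp μ (fun ω => f ω - g ω) (a - b) :=
  ⟨hf.1.sub hg.1, by rw [integral_sub hf.1 hg.1, hf.2, hg.2]⟩

theorem HasExp.const_mul {f : Ω → ℝ} {a : ℝ} (hf : HasExp μ f a) (r : ℝ) :
    HasExp μ (fun ω => r * f ω) (r * a) :=
  ⟨hf.1.const_mul r, by rw [integral_const_mul, hf.2]⟩

theorem HasExp.const [IsProbabilityMeasure μ] (r : ℝ) : HasExp μ (fun _ => r) r :=
  ⟨integrable_const r, by simp⟩

theorem HasExp.mono {f g : Ω → ℝ} {a b : ℝ} (hf : HasExp μ f a) (hg : HasExp μ g b)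
    (h : ∀ ω, f ω ≤ g ω) : a ≤ b := by
  rw [← hf.2, ← hg.2]
  exact integral_mono hf.1 hg.1 h

end Expectation

/-! ### Square-integrable random vectors -/

section L2

variable {d e : ℕ} {Ω : Type*} [MeasurableSpace Ω] {μ : Measure Ω}

theorem measurable_toEuclideanLin (M : Matrix (Fin d) (Fin e) ℝ) :
    Measurable fun x : Vec e => M.toEuclideanLin x :=
  M.toEuclideanLin.continuous_of_finiteDimensional.measurable

theorem IsL2.add {X Y : Ω → Vec d} (hX : IsL2 μ X) (hY : IsL2 μ Y) :
    IsL2 μ fun ω => X ω + Y ω :=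
  ⟨hX.1.add hY.1, hX.2.add hY.2⟩

theorem IsL2.sub {X Y : Ω → Vec d} (hX : IsL2 μ X) (hY : IsL2 μ Y) :
    IsL2 μ fun ω => X ω - Y ω :=
  ⟨hX.1.sub hY.1, hX.2.sub hY.2⟩

theorem IsL2.toEuclideanLin {X : Ω → Vec e} (hX : IsL2 μ X) (M : Matrix (Fin d) (Fin e) ℝ) :
    IsL2 μ fun ω => M.toEuclideanLin (X ω) :=
  ⟨(measurable_toEuclideanLin M).comp hX.1, M.toEuclideanLin.toContinuousLinearMap.comp_memLp' hX.2⟩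

theorem IsL2.const [IsFiniteMeasure μ] (x : Vec d) : IsL2 μ fun _ => x :=
  ⟨measurable_const, memLp_const x⟩

theorem IsL2.integrable [IsFiniteMeasure μ] {X : Ω → Vec d} (hX : IsL2 μ X) : Integrable X μ :=
  hX.2.integrable (by norm_num)

theorem IsL2.integrable_inner {X Y : Ω → Vec d} (hX : IsL2 μ X) (hY : IsL2 μ Y) :
    Integrable (fun ω => inner ℝ (X ω) (Y ω)) μ := by
  refine (hX.2.norm.integrable_mul hY.2.norm).mono'
    (hX.2.aestronglyMeasurable.inner hY.2.aestronglyMeasurable) (Filter.Eventually.of_forall ?_)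
  intro ω
  exact norm_inner_le_norm _ _

theorem IsL2.integrable_quad {X : Ω → Vec d} (hX : IsL2 μ X) (M : Matrix (Fin d) (Fin d) ℝ) :
    Integrable (fun ω => quad M (X ω)) μ :=
  hX.integrable_inner (hX.toEuclideanLin M)

theorem IsL2.integrable_const_inner [IsFiniteMeasure μ] {X : Ω → Vec d} (hX : IsL2 μ X)
    (x : Vec d) : Integrable (fun ω => inner ℝ x (X ω)) μ :=
  (IsL2.const x).integrable_inner hX

theorem IsL2.hasExp_const_inner [IsFiniteMeasure μ] {X : Ω → Vec d} (hX : IsL2 μ X)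
    (x : Vec d) : HasExp μ (fun ω => inner ℝ x (X ω)) (inner ℝ x (∫ ω, X ω ∂μ)) :=
  ⟨hX.integrable_const_inner x, integral_inner hX.integrable x⟩

theorem IsL2.integrable_norm_sq {X : Ω → Vec d} (hX : IsL2 μ X) :
    Integrable (fun ω => ‖X ω‖ ^ 2) μ :=
  (memLp_two_iff_integrable_sq_norm hX.2.aestronglyMeasurable).1 hX.2

theorem integral_toEuclideanLin {X : Ω → Vec e} (hX : Integrable X μ)
    (M : Matrix (Fin d) (Fin e) ℝ) :
    ∫ ω, M.toEuclideanLin (X ω) ∂μ = M.toEuclideanLin (∫ ω, X ω ∂μ) :=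
  M.toEuclideanLin.toContinuousLinearMap.integral_comp_comm hX

theorem isL2_of_map [IsProbabilityMeasure μ] {X : Ω → Vec d} (hX : Measurable X)
    {ρ : Measure (Vec d)} (hρ : IsP2 ρ) (h : μ.map X = ρ) : IsL2 μ X := by
  refine ⟨hX, hX.aestronglyMeasurable, ?_⟩
  have h2 := hρ.2
  rw [← h, lintegral_map (by fun_prop) hX] at h2
  rw [eLpNorm_lt_top_iff_lintegral_rpow_enorm_lt_top (by norm_num) (by norm_num)]
  simpa using h2

theorem trace_mul_covMatrix [IsProbabilityMeasure μ] {X : Ω → Vec d} (hX : IsL2 μ X)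
    (M : Matrix (Fin d) (Fin d) ℝ) :
    (M * covMatrix μ X).trace = ∫ ω, quad M (X ω) ∂μ - quad M (∫ ω, X ω ∂μ) := by
  have hi : ∀ i, MemLp (fun ω => X ω i) 2 μ := fun i => hX.2.eval_piLp i
  have hm : ∀ i, (∫ ω, X ω ∂μ) i = ∫ ω, X ω i ∂μ := fun i =>
    eval_integral_piLp (fun j => (hi j).integrable (by norm_num)) i
  have hq : ∀ x : Vec d, quad M x = ∑ i, ∑ j, M i j * (x j * x i) := fun x => by
    rw [quad_eq_dotProduct]
    simp only [dotProduct, Matrix.mulVec, star_trivial, Finset.mul_sum]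
    exact Finset.sum_congr rfl fun i _ => Finset.sum_congr rfl fun j _ => by ring
  have hint : ∀ i j, Integrable (fun ω => M i j * (X ω j * X ω i)) μ := fun i j =>
    ((hi j).integrable_mul (hi i)).const_mul _
  simp only [hq, hm]
  rw [integral_finsetSum _ fun i _ => integrable_finsetSum _ fun j _ => hint i j,
    ← Finset.sum_sub_distrib, Matrix.trace]
  refine Finset.sum_congr rfl fun i _ => ?_
  rw [integral_finsetSum _ fun j _ => hint i j, ← Finset.sum_sub_distrib, Matrix.diag_apply,
    Matrix.mul_apply]
  refine Finset.sum_congr rfl fun j _ => ?_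
  rw [integral_const_mul, ← mul_sub, covMatrix, Matrix.of_apply, covariance_eq_sub (hi j) (hi i)]
  rfl

/-- Jensen's inequality for a positive semidefinite form. -/
theorem quad_integral_le [IsProbabilityMeasure μ] {X : Ω → Vec d} (hX : IsL2 μ X)
    {M : Matrix (Fin d) (Fin d) ℝ} (hM : M.PosSemidef) :
    quad M (∫ ω, X ω ∂μ) ≤ ∫ ω, quad M (X ω) ∂μ := by
  set x := ∫ ω, X ω ∂μ with hx
  have e : ∀ ω, quad M (X ω) - 2 * inner ℝ (M.toEuclideanLin x) (X ω) + quad M x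
      = quad M (X ω - x) := fun ω => by
    rw [quad_sub_vec hM.isHermitian, real_inner_comm (X ω)]
  have h := (((hX.integrable_quad M).hasExp.sub
    ((hX.hasExp_const_inner (M.toEuclideanLin x)).const_mul 2)).add (HasExp.const (quad M x)))
  have h0 := (HasExp.const 0).mono h fun ω => by
    rw [e]
    exact quad_nonneg hM _
  rw [← hx, real_inner_comm] at h0
  have : inner ℝ x (M.toEuclideanLin x) = quad M x := rfl
  linarith

/-- The expectation of a bilinear form in independent vectors factorizes, and the centred noise has
mean zero. -/
theorem integral_inner_of_indepFun [IsProbabilityMeasure μ] {W : Ω → Vec e} {Z : Ω → Vec d}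
    (hW : IsL2 μ W) (hZ : IsL2 μ Z) (hind : IndepFun W Z μ) {a : ℕ}
    (M : Matrix (Fin a) (Fin d) ℝ) (N : Matrix (Fin a) (Fin e) ℝ) :
    ∫ ω, inner ℝ (M.toEuclideanLin (Z ω)) (N.toEuclideanLin (W ω - ∫ ω', W ω' ∂μ)) ∂μ = 0 := by
  set m := ∫ ω', W ω' ∂μ with hm
  have h1 : IndepFun (fun ω => M.toEuclideanLin (Z ω)) (fun ω => N.toEuclideanLin (W ω - m)) μ :=
    hind.symm.comp (measurable_toEuclideanLin M)
      ((measurable_toEuclideanLin N).comp (measurable_id.sub_const m))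
  have hW' := hW.sub (IsL2.const m)
  have h2 := h1.integral_bilin (hZ.toEuclideanLin M).integrable (hW'.toEuclideanLin N).integrable
    (innerSL ℝ)
  have h3 : ∫ ω, N.toEuclideanLin (W ω - m) ∂μ = 0 := by
    rw [integral_toEuclideanLin hW'.integrable, integral_sub hW.integrable (integrable_const _),
      ← hm]
    simp
  rw [h3, map_zero] at h2
  exact h2

end L2

/-! ### The dissipation inequality -/

section Dissipation

variable {n l m : ℕ} {Ω : Type*} [MeasurableSpace Ω] {μ : Measure Ω} [IsProbabilityMeasure μ]

/-- The covariance penalties merge with the other weights, at the price of concave terms in the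
means, which `quad_mean_sub_le` later bounds. -/
theorem Problem.stageCost_eq (S : Problem n l m) {X : Ω → Vec n} {U : Ω → Vec l} (hX : IsL2 μ X)
    (hU : IsL2 μ U) :
    S.stageCost μ X U = ∫ ω, (quad (S.Q₁ + S.Q₂) (X ω) + quad (S.R₁ + S.R₂) (U ω)
        + inner ℝ S.s (X ω) + inner ℝ S.v (U ω)) ∂μ
      + S.c - quad S.Q₂ (∫ ω, X ω ∂μ) - quad S.R₂ (∫ ω, U ω ∂μ) := by
  have i1 := (hX.integrable_quad S.Q₁).hasExp
  have i2 := (hU.integrable_quad S.R₁).hasExp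
  have i3 := hX.hasExp_const_inner S.s
  have i4 := hU.hasExp_const_inner S.v
  have i5 := (hX.integrable_quad S.Q₂).hasExp
  have i6 := (hU.integrable_quad S.R₂).hasExp
  rw [Problem.stageCost, trace_mul_covMatrix hX, trace_mul_covMatrix hU,
    ((((i1.add i2).add i3).add i4).add (HasExp.const _)).2]
  simp only [quad_add]
  rw [((((i1.add i5).add (i2.add i6)).add i3).add i4).2]
  ring

/-- Pointwise form of the dissipation identity. All terms that couple the deviation `(D, V)` with
the stationary state `y` cancel by the Riccati equation. -/
theorem dissipation_pointwise {A G P Q T : Matrix (Fin n) (Fin n) ℝ} {B : Matrix (Fin n) (Fin l) ℝ}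
    {R : Matrix (Fin l) (Fin l) ℝ} {K : Matrix (Fin l) (Fin n) ℝ} (hP : P.IsHermitian)
    (hQ : Q.IsHermitian) (hR : R.IsHermitian) (hric : P = Aᵀ * P * G + Q)
    (hgain : R * K + Bᵀ * P * G = 0) (s q xs xt D y D' y' w : Vec n) (v us ut V : Vec l)
    (hD' : D' = A.toEuclideanLin D + B.toEuclideanLin V) (hy' : y' = G.toEuclideanLin y + w) :
    (quad Q (D + y + xs) + quad R (V + K.toEuclideanLin y + us) + inner ℝ s (D + y + xs)
        + inner ℝ v (V + K.toEuclideanLin y + us))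
      - (quad Q (y + xt + xs) + quad R (K.toEuclideanLin y + ut + us) + inner ℝ s (y + xt + xs)
        + inner ℝ v (K.toEuclideanLin y + ut + us))
      + (quad (P + T) D - quad P (D + y) + inner ℝ q D)
      - (quad (P + T) D' - quad P (D' + y') + inner ℝ q D')
    = (quad Q D + quad R V + quad T D - quad T D' + inner ℝ (2 • Q.toEuclideanLin xs + s) (D - xt)
        + inner ℝ (2 • R.toEuclideanLin us + v) (V - ut) + inner ℝ q (D - D')
        - quad Q xt - quad R ut)
      + (quad P y' - quad P y + 2 * inner ℝ D' (P.toEuclideanLin w)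
        - 2 * inner ℝ (Q.toEuclideanLin xt) y
        - 2 * inner ℝ (R.toEuclideanLin ut) (K.toEuclideanLin y)) := by
  -- The Riccati equation is paired with `(D, y)` and the gain identity with `(V, y)`. Together with
  -- the expansion of `⟨D', P y'⟩`, they remove all coupling terms except the one with the noise
  -- `w`.
  have h1 : inner ℝ D (P.toEuclideanLin y)
      = inner ℝ (A.toEuclideanLin D) (P.toEuclideanLin (G.toEuclideanLin y))
        + inner ℝ D (Q.toEuclideanLin y) := by
    conv_lhs => rw [hric]
    rw [toEuclideanLin_add_apply, inner_add_right, toEuclideanLin_mul_apply,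
      toEuclideanLin_mul_apply, inner_transpose]
  have h2 : inner ℝ V (R.toEuclideanLin (K.toEuclideanLin y))
      + inner ℝ (B.toEuclideanLin V) (P.toEuclideanLin (G.toEuclideanLin y)) = 0 := by
    have := congrArg (fun M => inner ℝ V (Matrix.toEuclideanLin M y)) hgain
    simpa only [toEuclideanLin_add_apply, inner_add_right, toEuclideanLin_mul_apply,
      inner_transpose, map_zero, LinearMap.zero_apply, inner_zero_right] using this
  have h3 : inner ℝ D' (P.toEuclideanLin y')
      = inner ℝ (A.toEuclideanLin D) (P.toEuclideanLin (G.toEuclideanLin y))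
        + inner ℝ (B.toEuclideanLin V) (P.toEuclideanLin (G.toEuclideanLin y))
        + inner ℝ D' (P.toEuclideanLin w) := by
    rw [hy', map_add, inner_add_right, hD', inner_add_left]
  simp only [quad_add, quad_add_vec hP, quad_add_vec hQ, quad_add_vec hR, inner_add_left,
    inner_add_right, inner_sub_right, two_nsmul, real_inner_comm _ (Q.toEuclideanLin xs),
    real_inner_comm _ (R.toEuclideanLin us), real_inner_comm _ (Q.toEuclideanLin xt),
    real_inner_comm _ (R.toEuclideanLin ut)]
  linarith

end Dissipation

/-- The deterministic data on which the dissipation inequality rests: a Riccati solution `P`, a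
storage matrix `T` that makes the stage cost coercive with constant `c`, the steady states
`(xs, us)` and `(xt, ut)`, and a multiplier `q` for which `(xt, ut)` is optimal. -/
structure Problem.IsDesign {n l m : ℕ} (S : Problem n l m) (meanW : Vec m) (xs : Vec n) (us : Vec l)
    (P T : Matrix (Fin n) (Fin n) ℝ) (q xt : Vec n) (ut : Vec l) (c : ℝ) : Prop where
  posSemidef_Q₁ : S.Q₁.PosSemidef
  posSemidef_Q₂ : S.Q₂.PosSemidef
  posDef_R₁ : S.R₁.PosDef
  posSemidef_R₂ : S.R₂.PosSemidef
  posSemidef_P : P.PosSemidef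
  posDef_T : T.PosDef
  riccati : P = riccatiMap S.A S.B (S.Q₁ + S.Q₂) (S.R₁ + S.R₂) P
  c_pos : 0 < c
  coercive : ∀ (x : Vec n) (u : Vec l), c * (‖x‖ ^ 2 + ‖u‖ ^ 2) ≤ quad S.Q₁ x + quad S.R₁ u
    + quad T x - quad T (S.A.toEuclideanLin x + S.B.toEuclideanLin u)
  steady : S.A.toEuclideanLin xs + S.B.toEuclideanLin us + S.E.toEuclideanLin meanW + S.z = xs
  steady_shift : S.A.toEuclideanLin xt + S.B.toEuclideanLin ut = xt
  growth : ∀ (x : Vec n) (u : Vec l), c * (‖x - xt‖ ^ 2 + ‖u - ut‖ ^ 2) ≤ quad S.Q₁ x + quad S.R₁ u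
    + quad T x - quad T (S.A.toEuclideanLin x + S.B.toEuclideanLin u)
    + inner ℝ (2 • S.Q₁.toEuclideanLin xs + S.s) (x - xt)
    + inner ℝ (2 • S.R₁.toEuclideanLin us + S.v) (u - ut)
    + inner ℝ q (x - (S.A.toEuclideanLin x + S.B.toEuclideanLin u)) - quad S.Q₁ xt - quad S.R₁ ut

theorem Problem.exists_isDesign {n l m : ℕ} (S : Problem n l m) (meanW : Vec m)
    (hstab : IsStabilizable S.A S.B) (hQ₁ : S.Q₁.PosSemidef) (hQ₂ : S.Q₂.PosSemidef)
    (hR₁ : S.R₁.PosDef) (hR₂ : S.R₂.PosSemidef) (xs : Vec n) (us : Vec l)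
    (hsteady : (1 - S.A).toEuclideanLin xs - S.B.toEuclideanLin us =
      S.E.toEuclideanLin meanW + S.z) (hdet : IsDetectable S.A (CFC.sqrt S.Q₁)) :
    ∃ P T q xt ut c, S.IsDesign meanW xs us P T q xt ut c := by
  obtain ⟨T, c, hT, hc, hcoer⟩ := hdet.exists_storage S.B hQ₁ hR₁
  obtain ⟨P, hP, hric⟩ := hstab.exists_riccati (hQ₁.add hQ₂) (hR₁.add_posSemidef hR₂)
  obtain ⟨xt, ut, q, hst, hopt⟩ := exists_optimal_steadyState hc hcoer
    (2 • S.Q₁.toEuclideanLin xs + S.s) (2 • S.R₁.toEuclideanLin us + S.v)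
  have hst' : S.A.toEuclideanLin xt + S.B.toEuclideanLin ut = xt := by
    rw [toEuclideanLin_sub_apply, toEuclideanLin_one_apply, sub_sub, sub_eq_zero] at hst
    exact hst.symm
  refine ⟨P, T, q, xt, ut, c, hQ₁, hQ₂, hR₁, hR₂, hP, hT, hric, hc, hcoer, ?_, hst', ?_⟩
  · rw [toEuclideanLin_sub_apply, toEuclideanLin_one_apply] at hsteady
    rw [add_assoc _ _ S.z, ← hsteady]
    abel
  · exact optimal_steadyState_growth hQ₁.isHermitian hR₁.isHermitian hT.isHermitian hcoer hst' hopt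

theorem IsNoise.integral_eq {m : ℕ} {Ω : Type*} [MeasurableSpace Ω] {μ : Measure Ω}
    {W : ℕ → Ω → Vec m} (hW : IsNoise μ W) (k : ℕ) :
    ∫ ω, W k ω ∂μ = ∫ ω, W 0 ω ∂μ :=
  (hW.ident k).integral_eq

/-! ### Dissipativity at a stationary feedback pair -/

section Stationary

variable {n l m : ℕ} {Ω : Type*} [MeasurableSpace Ω] {μ : Measure Ω} [IsProbabilityMeasure μ]
  {S : Problem n l m} {W : ℕ → Ω → Vec m} {xs xt q : Vec n} {us ut : Vec l}
  {P T : Matrix (Fin n) (Fin n) ℝ} {c : ℝ} {Xs : ℕ → Ω → Vec n} {Us : ℕ → Ω → Vec l}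

theorem Problem.IsDesign.gain_eq {meanW : Vec m} (h : S.IsDesign meanW xs us P T q xt ut c) :
    (S.R₁ + S.R₂) * S.gain P + S.Bᵀ * P * (S.A + S.B * S.gain P) = 0 :=
  riccatiGain_eq (h.posDef_R₁.add_posSemidef h.posSemidef_R₂) h.posSemidef_P

theorem Problem.IsDesign.riccati_eq {meanW : Vec m} (h : S.IsDesign meanW xs us P T q xt ut c) :
    P = S.Aᵀ * P * (S.A + S.B * S.gain P) + (S.Q₁ + S.Q₂) :=
  h.riccati.trans riccatiMap_eq

theorem Problem.IsDesign.lyapunov {meanW : Vec m} (h : S.IsDesign meanW xs us P T q xt ut c)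
    (x : Vec n) : quad (P + T) ((S.A + S.B * S.gain P).toEuclideanLin x) + c * ‖x‖ ^ 2
      ≤ quad (P + T) x :=
  closedLoop_lyapunov h.c_pos h.coercive h.posSemidef_Q₂ h.posDef_R₁ h.posSemidef_R₂
    h.posSemidef_P h.riccati x

theorem Problem.IsStationaryPair.isL2_state (h : S.IsStationaryPair μ W Xs Us) (k : ℕ) :
    IsL2 μ (Xs k) := by
  obtain ⟨ρ, hρ, hk⟩ := h.law_state
  exact isL2_of_map (h.measurable_state k) hρ (hk k)

theorem Problem.IsStationaryPair.isL2_control (h : S.IsStationaryPair μ W Xs Us) (k : ℕ) :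
    IsL2 μ (Us k) := by
  obtain ⟨ρ, hρ, hk⟩ := h.law_control
  exact isL2_of_map (h.measurable_control k) hρ (hk k)

theorem Problem.IsStationaryPair.integral_state_eq {μ : Measure Ω}
    (h : S.IsStationaryPair μ W Xs Us) (k : ℕ)
    {F : Type*} [NormedAddCommGroup F] [NormedSpace ℝ F] {f : Vec n → F} (hf : Continuous f) :
    ∫ ω, f (Xs k ω) ∂μ = ∫ ω, f (Xs 0 ω) ∂μ := by
  obtain ⟨ρ, -, hk⟩ := h.law_state
  rw [← integral_map (h.measurable_state k).aemeasurable
      hf.aestronglyMeasurable,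
    ← integral_map (h.measurable_state 0).aemeasurable
      hf.aestronglyMeasurable, hk k, hk 0]

/-- The centred stationary state follows the closed loop. -/
theorem Problem.IsDesign.centered_succ {μ : Measure Ω} {meanW : Vec m}
    (h : S.IsDesign meanW xs us P T q xt ut c)
    (hst : S.IsFeedbackStationaryPair μ W P xs xt us ut Xs Us) (k : ℕ) (ω : Ω) :
    Xs (k + 1) ω - xt - xs = (S.A + S.B * S.gain P).toEuclideanLin (Xs k ω - xt - xs)
      + S.E.toEuclideanLin (W k ω - meanW) := by
  have h1 := congrFun (hst.1.dynamics k) ω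
  rw [Problem.step, hst.2 k ω] at h1
  rw [h1, toEuclideanLin_add_apply, toEuclideanLin_mul_apply]
  simp only [map_add, map_sub]
  linear_combination (norm := module) h.steady + h.steady_shift

/-- By equality of laws, the mean of the centred state is a fixed point of the closed-loop matrix;
the strict Lyapunov decrease leaves only zero. -/
theorem Problem.IsDesign.integral_centered (hW : IsNoise μ W)
    (h : S.IsDesign (∫ ω, W 0 ω ∂μ) xs us P T q xt ut c)
    (hst : S.IsFeedbackStationaryPair μ W P xs xt us ut Xs Us) (k : ℕ) :
    ∫ ω, (Xs k ω - xt - xs) ∂μ = 0 := by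
  have hcont : Continuous fun x : Vec n => x - xt - xs := by fun_prop
  have hX : ∀ k, IsL2 μ fun ω => Xs k ω - xt - xs := fun k =>
    ((hst.1.isL2_state k).sub (IsL2.const xt)).sub (IsL2.const xs)
  have hk := hst.1.integral_state_eq k hcont
  have hk1 := hst.1.integral_state_eq (k + 1) hcont
  rw [hk]
  set e := ∫ ω, (Xs 0 ω - xt - xs) ∂μ
  have hWk := (hW.isL2 k).sub (IsL2.const (∫ ω, W 0 ω ∂μ))
  have hW0 : ∫ ω, (W k ω - ∫ ω', W 0 ω' ∂μ) ∂μ = 0 := by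
    rw [integral_sub (hW.isL2 k).integrable (integrable_const _), hW.integral_eq k]
    simp
  simp only [h.centered_succ hst k] at hk1
  rw [integral_add ((hX k).toEuclideanLin _).integrable (hWk.toEuclideanLin _).integrable,
    integral_toEuclideanLin (hX k).integrable, integral_toEuclideanLin hWk.integrable, hk, hW0,
    map_zero, add_zero] at hk1
  have h1 := h.lyapunov e
  rw [hk1] at h1
  have h2 : c * ‖e‖ ^ 2 ≤ 0 := by linarith
  have h3 : ‖e‖ ^ 2 ≤ 0 := nonpos_of_mul_nonpos_right h2 h.c_pos
  have h4 : ‖e‖ = 0 := by nlinarith [norm_nonneg e]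
  exact norm_eq_zero.1 h4

/-- Lower bound for the terms of the stage cost that stem from the covariance penalty. -/
theorem quad_mean_sub_le {d : ℕ} {M : Matrix (Fin d) (Fin d) ℝ} (hM : M.PosSemidef)
    {D X X' : Ω → Vec d} {a b : Vec d} (hD : IsL2 μ D)
    (hX : ∫ ω, X ω ∂μ = ∫ ω, D ω ∂μ + a) (hX' : ∫ ω, X' ω ∂μ = b + a) :
    quad M (∫ ω, X ω ∂μ) - quad M (∫ ω, X' ω ∂μ)
      ≤ ∫ ω, quad M (D ω) ∂μ + inner ℝ (2 • M.toEuclideanLin a) (∫ ω, D ω ∂μ - b) - quad M b := by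
  have h1 := quad_integral_le hD hM
  rw [hX, hX', quad_add_vec hM.isHermitian, quad_add_vec hM.isHermitian, two_nsmul, inner_add_left,
    inner_sub_right, real_inner_comm _ (M.toEuclideanLin a), real_inner_comm b]
  linarith

/-- The dissipation inequality with a linear rate. -/
theorem Problem.IsDesign.dissipation (hW : IsNoise μ W)
    (h : S.IsDesign (∫ ω, W 0 ω ∂μ) xs us P T q xt ut c)
    (hst : S.IsFeedbackStationaryPair μ W P xs xt us ut Xs Us) (k : ℕ) {X : Ω → Vec n}
    {U : Ω → Vec l} (hX : IsL2 μ X) (hU : IsL2 μ U) (hWX : IndepFun (W k) X μ)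
    (hWU : IndepFun (W k) U μ) :
    c * ∫ ω, ‖X ω - Xs k ω‖ ^ 2 ∂μ ≤ S.stageCost μ X U - S.stageCost μ (Xs k) (Us k)
      + storage μ P T q xs xt Xs k X - storage μ P T q xs xt Xs (k + 1) (S.step X U (W k)) := by
  set K := S.gain P with hK
  set wm := ∫ ω, W 0 ω ∂μ with hwm
  have hXs := hst.1.isL2_state
  have hUs := hst.1.isL2_control
  set y : ℕ → Ω → Vec n := fun k ω => Xs k ω - xt - xs with hy
  have hyL : ∀ k, IsL2 μ (y k) := fun k => ((hXs k).sub (IsL2.const xt)).sub (IsL2.const xs)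
  have hy0 : ∫ ω, y k ω ∂μ = 0 := h.integral_centered hW hst k
  set D : Ω → Vec n := fun ω => X ω - Xs k ω + xt with hD
  have hDL : IsL2 μ D := (hX.sub (hXs k)).add (IsL2.const xt)
  set V : Ω → Vec l := fun ω => U ω - Us k ω + ut with hV
  have hVL : IsL2 μ V := (hU.sub (hUs k)).add (IsL2.const ut)
  set D' : Ω → Vec n := fun ω => S.A.toEuclideanLin (D ω) + S.B.toEuclideanLin (V ω) with hD'
  have hDL' : IsL2 μ D' := (hDL.toEuclideanLin _).add (hVL.toEuclideanLin _)
  set w : Ω → Vec n := fun ω => S.E.toEuclideanLin (W k ω - wm) with hw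
  have hwL : IsL2 μ w := ((hW.isL2 k).sub (IsL2.const wm)).toEuclideanLin _
  have eX : ∀ ω, X ω = D ω + y k ω + xs := fun ω => by simp only [hD, hy]; abel
  have eU : ∀ ω, U ω = V ω + K.toEuclideanLin (y k ω) + us := fun ω => by
    simp only [hV, hy, hst.2 k ω]
    abel
  have eXs : ∀ ω, Xs k ω = y k ω + xt + xs := fun ω => by simp only [hy]; abel
  have eUs : ∀ ω, Us k ω = K.toEuclideanLin (y k ω) + ut + us := fun ω => hst.2 k ω
  have eStep : ∀ ω, S.step X U (W k) ω = D' ω + y (k + 1) ω + xs := fun ω => by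
    have e1 := h.centered_succ hst k ω
    simp only [hy, hD', hD, hV, Problem.step, e1, hst.2 k ω]
    rw [toEuclideanLin_add_apply, toEuclideanLin_mul_apply]
    simp only [map_add, map_sub]
    linear_combination (norm := module) h.steady
  have eD : ∀ ω, X ω - (Xs k ω - xt) = D ω := fun ω => by simp only [hD]; abel
  have eDy : ∀ ω, X ω - xs = D ω + y k ω := fun ω => by rw [eX]; abel
  have eD' : ∀ ω, S.step X U (W k) ω - (Xs (k + 1) ω - xt) = D' ω := fun ω => by
    rw [eStep]; simp only [hy]; abel
  have eDy' : ∀ ω, S.step X U (W k) ω - xs = D' ω + y (k + 1) ω := fun ω => by rw [eStep]; abel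
  have hmX : ∫ ω, X ω ∂μ = ∫ ω, D ω ∂μ + xs := by
    simp only [eX]
    rw [integral_add (hDL.add (hyL k)).integrable (integrable_const _),
      integral_add hDL.integrable (hyL k).integrable, hy0]
    simp
  have hmXs : ∫ ω, Xs k ω ∂μ = xt + xs := by
    simp only [eXs, add_assoc]
    rw [integral_add (hyL k).integrable (integrable_const _), hy0]
    simp
  have hKy : ∫ ω, K.toEuclideanLin (y k ω) ∂μ = 0 := by
    rw [integral_toEuclideanLin (hyL k).integrable, hy0, map_zero]
  have hKyL := (hyL k).toEuclideanLin K
  have hmU : ∫ ω, U ω ∂μ = ∫ ω, V ω ∂μ + us := by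
    simp only [eU]
    rw [integral_add (hVL.add hKyL).integrable (integrable_const _),
      integral_add hVL.integrable hKyL.integrable, hKy]
    simp
  have hmUs : ∫ ω, Us k ω ∂μ = ut + us := by
    simp only [eUs, add_assoc]
    rw [integral_add hKyL.integrable (integrable_const _), hKy]
    simp
  have hQ := h.posSemidef_Q₁.add h.posSemidef_Q₂
  have hR := h.posDef_R₁.add_posSemidef h.posSemidef_R₂
  have z1 : HasExp μ (fun ω => quad P (y (k + 1) ω)) (∫ ω, quad P (y k ω) ∂μ) := by
    refine ⟨(hyL (k + 1)).integrable_quad P, ?_⟩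
    have hcont : Continuous fun x : Vec n => quad P (x - xt - xs) :=
      (continuous_quad P).comp (by fun_prop)
    exact (hst.1.integral_state_eq (k + 1) hcont).trans (hst.1.integral_state_eq k hcont).symm
  have z1' := ((hyL k).integrable_quad P).hasExp
  -- `D'` is affine in `X`, `Xs`, `U` and `Us`. Each of them is separately independent of `W k`, so
  -- by bilinearity no joint independence is needed.
  have z2 : HasExp μ (fun ω => inner ℝ (D' ω) (P.toEuclideanLin (w ω))) 0 := by
    have key : ∀ {d : ℕ} (M : Matrix (Fin n) (Fin d) ℝ) {Z : Ω → Vec d}, IsL2 μ Z →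
        IndepFun (W k) Z μ →
        HasExp μ (fun ω => inner ℝ (M.toEuclideanLin (Z ω)) (P.toEuclideanLin (w ω))) 0 := by
      intro d M Z hZ hind
      refine ⟨(hZ.toEuclideanLin M).integrable_inner (hwL.toEuclideanLin P), ?_⟩
      have := integral_inner_of_indepFun (hW.isL2 k) hZ hind M (P * S.E)
      rw [hW.integral_eq k, ← hwm] at this
      simpa only [toEuclideanLin_mul_apply] using this
    have k1 := key S.A hX hWX
    have k2 := key S.A (hXs k) (hst.1.indep_state k)
    have k3 := key S.B hU hWU
    have k4 := key S.B (hUs k) (hst.1.indep_control k)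
    have k5 := key S.A (IsL2.const xt) (indepFun_const_right _ _)
    have k6 := key S.B (IsL2.const ut) (indepFun_const_right _ _)
    have k7 := ((k1.sub k2).add k5).add ((k3.sub k4).add k6)
    simpa only [hD', hD, hV, map_add, map_sub, inner_add_left, inner_sub_left, sub_zero,
      add_zero] using k7
  have z3 := (hyL k).hasExp_const_inner ((S.Q₁ + S.Q₂).toEuclideanLin xt)
  rw [hy0, inner_zero_right] at z3
  have z4 := hKyL.hasExp_const_inner ((S.R₁ + S.R₂).toEuclideanLin ut)
  rw [hKy, inner_zero_right] at z4
  -- Lower bound before the concave mean terms are subtracted: the rate, the `Q₂` and `R₂` parts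
  -- that Jensen's inequality will consume, and the terms of mean zero.
  have low := (((hX.sub (hXs k)).integrable_norm_sq.hasExp.const_mul c).add
    (((((hDL.integrable_quad S.Q₂).hasExp.add
        ((hDL.hasExp_const_inner (2 • S.Q₂.toEuclideanLin xs)).sub
          (HasExp.const (inner ℝ (2 • S.Q₂.toEuclideanLin xs) xt)))).sub
        (HasExp.const (quad S.Q₂ xt)))).add
      ((((hVL.integrable_quad S.R₂).hasExp.add
        ((hVL.hasExp_const_inner (2 • S.R₂.toEuclideanLin us)).sub
          (HasExp.const (inner ℝ (2 • S.R₂.toEuclideanLin us) ut)))).sub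
        (HasExp.const (quad S.R₂ ut)))))).add
    ((((z1.sub z1').add (z2.const_mul 2)).sub (z3.const_mul 2)).sub (z4.const_mul 2))
  have cost : ∀ {X : Ω → Vec n} {U : Ω → Vec l}, IsL2 μ X → IsL2 μ U →
      Integrable (fun ω => quad (S.Q₁ + S.Q₂) (X ω) + quad (S.R₁ + S.R₂) (U ω)
        + inner ℝ S.s (X ω) + inner ℝ S.v (U ω)) μ := fun hX hU =>
    (((hX.integrable_quad _).add (hU.integrable_quad _)).add
      (hX.integrable_const_inner _)).add (hU.integrable_const_inner _)
  have i3 : Integrable (fun ω => quad (P + T) (X ω - (Xs k ω - xt)) - quad P (X ω - xs)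
      + inner ℝ q (X ω - (Xs k ω - xt))) μ := by
    simp only [eD, eDy]
    exact ((hDL.integrable_quad _).sub ((hDL.add (hyL k)).integrable_quad _)).add
      (hDL.integrable_const_inner _)
  have i4 : Integrable (fun ω => quad (P + T) (S.step X U (W k) ω - (Xs (k + 1) ω - xt))
      - quad P (S.step X U (W k) ω - xs)
      + inner ℝ q (S.step X U (W k) ω - (Xs (k + 1) ω - xt))) μ := by
    simp only [eD', eDy']
    exact ((hDL'.integrable_quad _).sub ((hDL'.add (hyL (k + 1))).integrable_quad _)).add
      (hDL'.integrable_const_inner _)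
  have high := ((((cost hX hU).hasExp.sub (cost (hXs k) (hUs k)).hasExp).add i3.hasExp).sub
    i4.hasExp)
  have hle := low.mono high fun ω => by
    have e1 := dissipation_pointwise (T := T) h.posSemidef_P.isHermitian hQ.isHermitian
      hR.isHermitian h.riccati_eq h.gain_eq S.s q xs xt (D ω) (y k ω) (D' ω) (y (k + 1) ω) (w ω)
      S.v us ut (V ω) rfl (h.centered_succ hst k ω)
    rw [← hK, ← eX, ← eU, ← eXs, ← eUs] at e1
    have e2 := h.growth (D ω) (V ω)
    have e3 : D ω - xt = X ω - Xs k ω := add_sub_cancel_right _ _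
    have e4 : 0 ≤ c * ‖V ω - ut‖ ^ 2 := mul_nonneg h.c_pos.le (sq_nonneg _)
    have e5 : S.A.toEuclideanLin (D ω) + S.B.toEuclideanLin (V ω) = D' ω := rfl
    rw [eD, eD', eDy, eDy', e1]
    rw [← e3]
    rw [e5] at e2
    simp only [toEuclideanLin_add_apply, quad_add, smul_add, inner_add_left, inner_sub_right]
      at e2 ⊢
    linarith
  have m1 := quad_mean_sub_le h.posSemidef_Q₂ hDL hmX hmXs
  have m2 := quad_mean_sub_le h.posSemidef_R₂ hVL hmU hmUs
  rw [inner_sub_right] at m1 m2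
  rw [S.stageCost_eq hX hU, S.stageCost_eq (hXs k) (hUs k), storage, storage]
  linarith

end Stationary

/-! ### From strict dissipativity to the turnpike property -/

section Turnpike

variable {n l m : ℕ} {Ω : Type*} [MeasurableSpace Ω] {μ : Measure Ω}
  {S : Problem n l m} {W : ℕ → Ω → Vec m} {Xs : ℕ → Ω → Vec n} {Us : ℕ → Ω → Vec l}

/-- The joint law of `(X, Y)` is an admissible coupling. -/
theorem wasserstein_map_le {X Y : Ω → Vec n} (hX : Measurable X) (hY : Measurable Y) (p : ℝ≥0∞) :
    wasserstein p (μ.map X) (μ.map Y) ≤ eLpNorm (fun ω => X ω - Y ω) p μ := by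
  have hXY : Measurable fun ω => (X ω, Y ω) := hX.prodMk hY
  have h1 : (μ.map fun ω => (X ω, Y ω)).map Prod.fst = μ.map X := by
    rw [Measure.map_map measurable_fst hXY]
    rfl
  have h2 : (μ.map fun ω => (X ω, Y ω)).map Prod.snd = μ.map Y := by
    rw [Measure.map_map measurable_snd hXY]
    rfl
  refine (iInf₂_le (μ.map fun ω => (X ω, Y ω)) ⟨h1, h2⟩).trans ?_
  have h3 : AEStronglyMeasurable (fun q : Vec n × Vec n => q.1 - q.2)
      (μ.map fun ω => (X ω, Y ω)) := by fun_prop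
  rw [eLpNorm_map_measure h3 hXY.aemeasurable]
  rfl

theorem wasserstein_two_map_le {X Y : Ω → Vec n} (hX : IsL2 μ X) (hY : IsL2 μ Y) {ε : ℝ}
    (hε : 0 ≤ ε) (h : ∫ ω, ‖X ω - Y ω‖ ^ 2 ∂μ ≤ ε ^ 2) :
    wasserstein 2 (μ.map X) (μ.map Y) ≤ ENNReal.ofReal ε := by
  refine (wasserstein_map_le hX.1 hY.1 2).trans ?_
  rw [(hX.sub hY).2.eLpNorm_eq_integral_rpow_norm (by norm_num) (by norm_num)]
  refine ENNReal.ofReal_le_ofReal ?_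
  have h0 : 0 ≤ ∫ ω, ‖X ω - Y ω‖ ^ 2 ∂μ := integral_nonneg fun ω => by positivity
  simp only [ENNReal.toReal_ofNat, Real.rpow_ofNat]
  rw [← one_div, ← Real.sqrt_eq_rpow]
  exact Real.sqrt_le_iff.2 ⟨hε, h⟩

theorem IsL2.step [IsProbabilityMeasure μ] {X : Ω → Vec n} {U : Ω → Vec l} {V : Ω → Vec m}
    (hX : IsL2 μ X) (hU : IsL2 μ U) (hV : IsL2 μ V) : IsL2 μ (S.step X U V) :=
  (((hX.toEuclideanLin _).add (hU.toEuclideanLin _)).add (hV.toEuclideanLin _)).add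
    (IsL2.const S.z)

theorem Problem.IsControl.isL2_traj [IsProbabilityMeasure μ] (hW : IsNoise μ W) {X₀ : Ω → Vec n}
    (hX₀ : IsL2 μ X₀) {N : ℕ} {U : ℕ → Ω → Vec l} (hU : S.IsControl μ W N X₀ U) {k : ℕ}
    (hk : k ≤ N) : IsL2 μ (S.traj W X₀ U k) := by
  induction k with
  | zero => exact hX₀
  | succ k ih => exact (ih (by omega)).step (hU.isL2 k (by omega)) (hW.isL2 k)

theorem Problem.closeTimes_eq (S : Problem n l m) (X₀ : Ω → Vec n) (U : ℕ → Ω → Vec l) (N : ℕ)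
    (ε : ℝ) [DecidablePred fun k =>
      wasserstein 2 (μ.map (S.traj W X₀ U k)) (μ.map (Xs k)) ≤ ENNReal.ofReal ε] :
    S.closeTimes μ W Xs N X₀ U ε = ((Finset.range N).filter fun k =>
      wasserstein 2 (μ.map (S.traj W X₀ U k)) (μ.map (Xs k)) ≤ ENNReal.ofReal ε).card := by
  rw [Problem.closeTimes, ← Set.ncard_coe_finset]
  congr 1
  ext k
  simp

theorem IsKInfty.nonneg {α : ℝ → ℝ} (hα : IsKInfty α) {r : ℝ} (hr : 0 ≤ r) : 0 ≤ α r := by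
  rw [← hα.map_zero]
  exact hα.strictMonoOn.monotoneOn Set.self_mem_Ici hr hr

theorem IsKInfty.pos {α : ℝ → ℝ} (hα : IsKInfty α) {r : ℝ} (hr : 0 < r) : 0 < α r := by
  rw [← hα.map_zero]
  exact hα.strictMonoOn Set.self_mem_Ici hr.le hr

/-- Strict dissipativity implies the turnpike property. -/
theorem Problem.IsStrictlyDissipative.turnpike [IsProbabilityMeasure μ] (hW : IsNoise μ W)
    (hst : S.IsStationaryPair μ W Xs Us) {lam : ℕ → (Ω → Vec n) → ℝ} {α : ℝ → ℝ}
    (hd : S.IsStrictlyDissipative μ W Xs Us lam α) :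
    S.TurnpikeInDistribution μ W Xs Us fun ε => α (ε ^ 2) := by
  classical
  intro X₀ hX₀
  obtain ⟨M, hM⟩ := hd.bddBelow
  -- The telescoped storage is at most its initial value minus its uniform lower bound, which
  -- depends on `X₀` but not on the horizon or the control.
  refine ⟨lam 0 X₀ - M, fun δ _ N U hU hJ ε hε => ?_⟩
  set X := S.traj W X₀ U with hXdef
  set dist : ℕ → ℝ := fun k => ∫ ω, ‖X k ω - Xs k ω‖ ^ 2 ∂μ with hdist
  have hdist0 : ∀ k, 0 ≤ dist k := fun k => integral_nonneg fun ω => by positivity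
  have hsum : ∑ k ∈ Finset.range N, α (dist k) ≤ δ + (lam 0 X₀ - M) := by
    have h1 : ∀ k ∈ Finset.range N, α (dist k) ≤ (S.stageCost μ (X k) (U k)
        - S.stageCost μ (Xs k) (Us k)) + (lam k (X k) - lam (k + 1) (X (k + 1))) := fun k hk => by
      have hkN := Finset.mem_range.1 hk
      have := hd.ineq k (X k) (U k) (hU.isL2_traj hW hX₀ hkN.le) (hU.isL2 k hkN)
        (hU.indep_state k hkN) (hU.indep_control k hkN)
      have e : X (k + 1) = S.step (X k) (U k) (W k) := rfl
      rw [e]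
      linarith
    have h2 := Finset.sum_le_sum h1
    rw [Finset.sum_add_distrib, Finset.sum_sub_distrib,
      Finset.sum_range_sub' (fun k => lam k (X k))] at h2
    have h3 := hM N (X N) (hU.isL2_traj hW hX₀ le_rfl)
    have e0 : X 0 = X₀ := rfl
    rw [e0] at h2
    rw [Problem.totalCost] at hJ
    linarith
  set close : ℕ → Prop := fun k =>
    wasserstein 2 (μ.map (X k)) (μ.map (Xs k)) ≤ ENNReal.ofReal ε with hclose
  have hfar : ∀ k ∈ (Finset.range N).filter (fun k => ¬ close k), α (ε ^ 2) ≤ α (dist k) := by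
    intro k hk
    obtain ⟨hkN, hk⟩ := Finset.mem_filter.1 hk
    refine hd.isKInfty.strictMonoOn.monotoneOn (sq_nonneg ε) (hdist0 k) ?_
    by_contra hlt
    exact hk (wasserstein_two_map_le (hU.isL2_traj hW hX₀ (Finset.mem_range.1 hkN).le)
      (hst.isL2_state k) hε.le (not_le.1 hlt).le)
  have hcard : (((Finset.range N).filter fun k => ¬ close k).card : ℝ) * α (ε ^ 2)
      ≤ δ + (lam 0 X₀ - M) := by
    rw [← nsmul_eq_mul]
    refine (Finset.card_nsmul_le_sum _ _ _ hfar).trans (le_trans ?_ hsum)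
    exact Finset.sum_le_sum_of_subset_of_nonneg (Finset.filter_subset _ _)
      fun k _ _ => hd.isKInfty.nonneg (hdist0 k)
  have hN := Finset.card_filter_add_card_filter_not (s := Finset.range N) close
  rw [Finset.card_range] at hN
  have hN' : (((Finset.range N).filter close).card : ℝ)
      + ((Finset.range N).filter fun k => ¬ close k).card = N := by exact_mod_cast hN
  rw [S.closeTimes_eq X₀ U N ε]
  have := (le_div_iff₀ (hd.isKInfty.pos (by positivity : 0 < ε ^ 2))).2 hcard
  linarith

theorem Problem.TurnpikeInDistribution.mono {β β' : ℝ → ℝ}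
    (h : S.TurnpikeInDistribution μ W Xs Us β) (hβ' : ∀ ε, 0 < ε → 0 < β' ε)
    (hle : ∀ ε, 0 < ε → β' ε ≤ β ε) : S.TurnpikeInDistribution μ W Xs Us β' := by
  classical
  intro X₀ hX₀
  obtain ⟨C, hC⟩ := h X₀ hX₀
  refine ⟨C, fun δ hδ N U hU hJ ε hε => ?_⟩
  have h1 := hC δ hδ N U hU hJ ε hε
  have h2 : S.closeTimes μ W Xs N X₀ U ε ≤ N := by
    rw [S.closeTimes_eq X₀ U N ε]
    exact (Finset.card_filter_le _ _).trans (Finset.card_range N).le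
  have h3 : (S.closeTimes μ W Xs N X₀ U ε : ℝ) ≤ N := by exact_mod_cast h2
  have hβ := (hβ' ε hε).trans_le (hle ε hε)
  -- Shrinking the denominator weakens the bound only for a nonnegative numerator; a negative one
  -- would force more than `N` close times.
  have h4 : 0 ≤ δ + C := by
    by_contra hneg
    have := div_neg_of_neg_of_pos (not_le.1 hneg) hβ
    linarith
  have h5 : (δ + C) / β ε ≤ (δ + C) / β' ε :=
    div_le_div_of_nonneg_left h4 (hβ' ε hε) (hle ε hε)
  linarith

end Turnpike

/-! ### Explicit rates -/

section Rates

theorem isKInfty_const_mul {c : ℝ} (hc : 0 < c) : IsKInfty fun r => c * r where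
  continuousOn := by fun_prop
  strictMonoOn := fun _ _ _ _ h => mul_lt_mul_of_pos_left h hc
  map_zero := mul_zero c
  unbounded := by
    rintro ⟨M, hM⟩
    have h := hM ⟨(|M| + 1) / c, Set.mem_Ici.2 (by positivity), rfl⟩
    simp only at h
    rw [mul_div_cancel₀ _ hc.ne'] at h
    linarith [le_abs_self M]

theorem isKInfty_const_mul_min {c : ℝ} (hc : 0 < c) : IsKInfty fun r => c * min r (r ^ 4) where
  continuousOn := by fun_prop
  strictMonoOn := fun x hx y _ h =>
    mul_lt_mul_of_pos_left (min_lt_min h (pow_lt_pow_left₀ h hx (by norm_num))) hc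
  map_zero := by simp
  unbounded := by
    rintro ⟨M, hM⟩
    have h1 : 1 ≤ |M| / c + 1 := by
      have : 0 ≤ |M| / c := by positivity
      linarith
    -- At arguments at least one the minimum is the linear branch.
    have h := hM ⟨|M| / c + 1, Set.mem_Ici.2 (zero_le_one.trans h1), rfl⟩
    simp only at h
    rw [min_eq_left (le_self_pow₀ h1 (by norm_num)), mul_add, mul_div_cancel₀ _ hc.ne'] at h
    linarith [le_abs_self M]

end Rates

/-! ### Lower bound of the storage function -/

section Stationary

variable {n l m : ℕ} {Ω : Type*} [MeasurableSpace Ω] {μ : Measure Ω} [IsProbabilityMeasure μ]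
  {S : Problem n l m} {W : ℕ → Ω → Vec m} {xs xt q : Vec n} {us ut : Vec l}
  {P T : Matrix (Fin n) (Fin n) ℝ} {c : ℝ} {Xs : ℕ → Ω → Vec n} {Us : ℕ → Ω → Vec l}

/-- With `X - xs = D + y` the `P`-quadratic terms in `D` cancel, leaving `quad T D`, a term linear
in `D` with coefficient `g`, and `-quad P y`. Minimizing over `D` gives a function of the stationary
state alone, and its mean does not depend on `k`. -/
theorem storage_bddBelow (hP : P.IsHermitian) (hT : T.PosDef)
    (hst : S.IsStationaryPair μ W Xs Us) :
    ∃ M : ℝ, ∀ k X, IsL2 μ X → M ≤ storage μ P T q xs xt Xs k X := by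
  obtain ⟨t, ht, hTle⟩ := exists_le_quad hT
  set g : Vec n → Vec n := fun x => q - (2 : ℝ) • P.toEuclideanLin (x - xt - xs) with hg
  have hPc : Continuous fun x : Vec n => P.toEuclideanLin x :=
    P.toEuclideanLin.continuous_of_finiteDimensional
  have hgc : Continuous g := by
    have h1 : Continuous fun x : Vec n => P.toEuclideanLin (x - xt - xs) := by
      simp only [map_sub]
      fun_prop
    fun_prop
  -- The first summand is the minimum over `D` of `t ‖D‖ ^ 2 + ⟨g x, D⟩`.
  set ψ : Vec n → ℝ := fun x => -((4 * t)⁻¹ * ‖g x‖ ^ 2) - quad P (x - xt - xs) with hψ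
  have hψc : Continuous ψ := by
    have h1 : Continuous fun x : Vec n => quad P (x - xt - xs) :=
      (continuous_quad P).comp (by fun_prop)
    fun_prop
  refine ⟨∫ ω, ψ (Xs 0 ω) ∂μ, fun k X hX => ?_⟩
  rw [← hst.integral_state_eq k hψc, storage]
  have hXs := hst.isL2_state k
  have hy : IsL2 μ fun ω => Xs k ω - xt - xs := (hXs.sub (IsL2.const xt)).sub (IsL2.const xs)
  have hD : IsL2 μ fun ω => X ω - (Xs k ω - xt) := hX.sub (hXs.sub (IsL2.const xt))
  have hgL : IsL2 μ fun ω => g (Xs k ω) :=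
    ⟨hgc.measurable.comp hXs.1,
      (memLp_const q).sub ((hy.toEuclideanLin P).2.const_smul (2 : ℝ))⟩
  refine integral_mono ((hgL.integrable_norm_sq.const_mul _).neg.sub (hy.integrable_quad P))
    (((hD.integrable_quad _).sub ((hX.sub (IsL2.const xs)).integrable_quad _)).add
      (hD.integrable_const_inner _)) fun ω => ?_
  simp only [hψ, hg]
  set D := X ω - (Xs k ω - xt) with hDdef
  set y := Xs k ω - xt - xs with hydef
  have e : X ω - xs = D + y := by
    rw [hDdef, hydef]
    abel
  rw [e, quad_add, quad_add_vec hP]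
  have h1 := hTle D
  have h2 : -(t * ‖D‖ ^ 2 + (4 * t)⁻¹ * ‖q - (2 : ℝ) • P.toEuclideanLin y‖ ^ 2)
      ≤ inner ℝ (q - (2 : ℝ) • P.toEuclideanLin y) D := by
    set v := q - (2 : ℝ) • P.toEuclideanLin y
    have h3 := neg_le_of_abs_le (abs_real_inner_le_norm v D)
    have h4 : ‖v‖ * ‖D‖ ≤ t * ‖D‖ ^ 2 + (4 * t)⁻¹ * ‖v‖ ^ 2 := by
      have h5 : 0 ≤ (4 * t)⁻¹ * (2 * t * ‖D‖ - ‖v‖) ^ 2 := by positivity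
      have h6 : (4 * t)⁻¹ * (2 * t * ‖D‖ - ‖v‖) ^ 2
          = t * ‖D‖ ^ 2 - ‖v‖ * ‖D‖ + (4 * t)⁻¹ * ‖v‖ ^ 2 := by
        field_simp
        ring
      linarith
    linarith
  rw [inner_sub_left, inner_smul_left, real_inner_comm D (P.toEuclideanLin y)] at h2
  simp only [RCLike.conj_to_real] at h2
  linarith

theorem Problem.IsDesign.isStrictlyDissipative (hW : IsNoise μ W)
    (h : S.IsDesign (∫ ω, W 0 ω ∂μ) xs us P T q xt ut c)
    (hst : S.IsFeedbackStationaryPair μ W P xs xt us ut Xs Us) {α : ℝ → ℝ} (hα : IsKInfty α)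
    (hαc : ∀ r, 0 ≤ r → α r ≤ c * r) :
    S.IsStrictlyDissipative μ W Xs Us (storage μ P T q xs xt Xs) α where
  isKInfty := hα
  bddBelow := storage_bddBelow h.posSemidef_P.isHermitian h.posDef_T hst.1
  ineq := fun k _ _ hX hU hWX hWU =>
    (hαc _ (integral_nonneg fun ω => by positivity)).trans
      (h.dissipation hW hst k hX hU hWX hWU)

end Stationary

/-! ### Existence of stationary pairs -/

theorem IsL2.isP2_map {d : ℕ} {Ω : Type*} [MeasurableSpace Ω] {μ : Measure Ω}
    [IsProbabilityMeasure μ] {X : Ω → Vec d} (hX : IsL2 μ X) : IsP2 (μ.map X) := by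
  refine ⟨Measure.isProbabilityMeasure_map hX.1.aemeasurable, ?_⟩
  rw [lintegral_map (by fun_prop) hX.1]
  have := hX.2.2
  rw [eLpNorm_lt_top_iff_lintegral_rpow_enorm_lt_top (by norm_num) (by norm_num)] at this
  simpa using this

/-! ### Independence of the noise and sampling from a law -/

section Independence

variable {Ω : Type*} [MeasurableSpace Ω] {μ : Measure Ω} [IsProbabilityMeasure μ]

/-- Regrouping mutual independence: both hypotheses together make the joint law a triple product,
which is then reassociated. -/
theorem indepFun_prodMk_left {α β γ : Type*} [MeasurableSpace α] [MeasurableSpace β]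
    [MeasurableSpace γ] {X : Ω → α} {Y : Ω → β} {Z : Ω → γ} (hX : Measurable X)
    (hY : Measurable Y) (hZ : Measurable Z) (h₁ : IndepFun X (fun ω => (Y ω, Z ω)) μ)
    (h₂ : IndepFun Y Z μ) : IndepFun (fun ω => (X ω, Y ω)) Z μ := by
  have := Measure.isProbabilityMeasure_map (μ := μ) hX.aemeasurable
  have := Measure.isProbabilityMeasure_map (μ := μ) hY.aemeasurable
  have := Measure.isProbabilityMeasure_map (μ := μ) hZ.aemeasurable
  have hXY : IndepFun X Y μ := h₁.comp measurable_id measurable_fst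
  rw [indepFun_iff_map_prod_eq_prod_map_map (hX.prodMk hY).aemeasurable hZ.aemeasurable]
  rw [indepFun_iff_map_prod_eq_prod_map_map hX.aemeasurable (hY.prodMk hZ).aemeasurable,
    (indepFun_iff_map_prod_eq_prod_map_map hY.aemeasurable hZ.aemeasurable).1 h₂] at h₁
  rw [(indepFun_iff_map_prod_eq_prod_map_map hX.aemeasurable hY.aemeasurable).1 hXY]
  refine MeasurableEquiv.prodAssoc.map_measurableEquiv_injective ?_
  rw [Measure.prodAssoc_prod, ← h₁,
    Measure.map_map MeasurableEquiv.prodAssoc.measurable ((hX.prodMk hY).prodMk hZ)]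
  rfl

theorem indepFun_tail {μ : Measure Ω} {α : Type*} [MeasurableSpace α] {W : ℕ → Ω → α}
    (hW : iIndepFun W μ) (hm : ∀ k, Measurable (W k)) (k : ℕ) :
    IndepFun (W k) (fun ω (j : ℕ) => W (k + 1 + j) ω) μ := by
  have h := indep_iSup_of_disjoint (fun i => (hm i).comap_le) hW.iIndep
    (S := {k}) (T := Set.Ioi k) (by simp)
  refine (indep_of_indep_of_le_left (indep_of_indep_of_le_right h ?_) ?_ : Indep _ _ μ)
  · rw [← measurable_iff_comap_le]
    refine @measurable_pi_iff _ _ _ (_) _ _ |>.2 fun j => ?_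
    rw [measurable_iff_comap_le]
    exact le_iSup₂_of_le (k + 1 + j) (by simp; omega) le_rfl
  · exact le_iSup₂_of_le k rfl le_rfl

theorem IsNoise.map_shift {μ : Measure Ω} {m : ℕ} {W : ℕ → Ω → Vec m} (hW : IsNoise μ W) :
    μ.map (fun ω (j : ℕ) => W (j + 1) ω) = μ.map (fun ω (j : ℕ) => W j ω) := by
  have h1 : iIndepFun (fun j => W (j + 1)) μ := hW.indep.precomp (add_left_injective 1)
  rw [h1.map_fun_eq_infinitePi_map fun j => (hW.isL2 _).1,
    hW.indep.map_fun_eq_infinitePi_map fun j => (hW.isL2 _).1]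
  congr 1
  funext j
  rw [(hW.ident (j + 1)).map_eq, (hW.ident j).map_eq]

/-- Every Borel probability measure on `ℝᵈ` is the law of a function of a uniform variable. -/
theorem exists_measurable_map_uniform {d : ℕ} (ρ : Measure (Vec d)) [IsProbabilityMeasure ρ] :
    ∃ f : ℝ → Vec d, Measurable f ∧ (volume.restrict (Set.Icc (0 : ℝ) 1)).map f = ρ := by
  obtain ⟨f, hf, hmap⟩ := Measure.exists_measurable_map_eq ρ
  -- `f` is defined on the unit interval only; the projection extends it to `ℝ` and is the identity
  -- where the restricted measure lives.
  have hp : Measurable (Set.projIcc (0 : ℝ) 1 zero_le_one) := continuous_projIcc.measurable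
  refine ⟨f ∘ Set.projIcc 0 1 zero_le_one, hf.comp hp, ?_⟩
  rw [← map_comap_subtype_coe measurableSet_Icc, ← Measure.Subtype.volume_def,
    Measure.map_map (hf.comp hp) measurable_subtype_coe, ← hmap]
  congr 1
  funext x
  simp

end Independence

/-! ### Geometric decay and the invariant law -/

section Decay

variable {n m : ℕ}

/-- Geometric decay from a quadratic Lyapunov function. -/
theorem exists_norm_pow_le {G L : Matrix (Fin n) (Fin n) ℝ} (hL : L.PosDef) {c : ℝ} (hc : 0 < c)
    (h : ∀ x : Vec n, quad L (G.toEuclideanLin x) + c * ‖x‖ ^ 2 ≤ quad L x) :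
    ∃ a r : ℝ, 0 < a ∧ 0 ≤ r ∧ r < 1 ∧
      ∀ (j : ℕ) (x : Vec n), ‖(G ^ j).toEuclideanLin x‖ ≤ a * r ^ j * ‖x‖ := by
  obtain ⟨C, hC, hle⟩ := quad_le L
  obtain ⟨b, hb, hge⟩ := exists_le_quad hL
  -- Since `L (G x) ≤ L x ≤ C ‖x‖ ^ 2`, the decrease gives `(1 + c / C) L (G x) ≤ L x`. This factor
  -- lies in `[0, 1)` without comparing `c` with `C`.
  set θ : ℝ := C / (C + c) with hθ
  have hθ0 : 0 ≤ θ := by positivity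
  have hθ1 : θ < 1 := by
    rw [hθ, div_lt_one (by positivity)]
    linarith
  have hstep : ∀ x : Vec n, quad L (G.toEuclideanLin x) ≤ θ * quad L x := fun x => by
    rw [hθ, div_mul_eq_mul_div, le_div_iff₀ (by positivity)]
    have h0 := quad_nonneg hL.posSemidef (G.toEuclideanLin x)
    have h1 := mul_le_mul_of_nonneg_left (h x) hC.le
    have h2 := mul_le_mul_of_nonneg_left (hle x) hc.le
    have h3 := mul_le_mul_of_nonneg_left (h x) hc.le
    have h4 : 0 ≤ c * (c * ‖x‖ ^ 2) := by positivity
    nlinarith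
  have hpow : ∀ (j : ℕ) (x : Vec n), quad L ((G ^ j).toEuclideanLin x) ≤ θ ^ j * quad L x := by
    intro j
    induction j with
    | zero => intro x; simp
    | succ j ih =>
      intro x
      rw [pow_succ' G, toEuclideanLin_mul_apply, pow_succ', mul_assoc]
      exact (hstep _).trans (mul_le_mul_of_nonneg_left (ih x) hθ0)
  refine ⟨√(C / b), √θ, by positivity, by positivity, ?_, fun j x => ?_⟩
  · rw [Real.sqrt_lt' one_pos]
    simpa using hθ1
  · refine (sq_le_sq₀ (norm_nonneg _) (by positivity)).1 ?_
    rw [mul_pow, mul_pow, ← pow_mul, mul_comm j 2, pow_mul, Real.sq_sqrt hθ0,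
      Real.sq_sqrt (by positivity), div_mul_eq_mul_div, div_mul_eq_mul_div, le_div_iff₀ hb]
    have h1 := hge ((G ^ j).toEuclideanLin x)
    have h2 := hpow j x
    have h3 := mul_le_mul_of_nonneg_left (hle x) (pow_nonneg hθ0 j)
    linarith

variable {Ω : Type*} [MeasurableSpace Ω] {μ : Measure Ω} [IsProbabilityMeasure μ]

/-- A series of random vectors that converges absolutely in `L²` converges almost surely, and its
sum is square integrable. -/
theorem ae_summable_and_isL2_tsum {f : ℕ → Ω → Vec n} (hf : ∀ j, IsL2 μ (f j)) {b : ℕ → ℝ≥0∞}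
    (hb : ∑' j, b j ≠ ∞) (hfb : ∀ j, eLpNorm (f j) 2 μ ≤ b j) :
    (∀ᵐ ω ∂μ, Summable fun j => f j ω) ∧ IsL2 μ fun ω => ∑' j, f j ω := by
  have hsum : ∀ᵐ ω ∂μ, Summable fun j => f j ω := by
    have hint : ∫⁻ ω, ∑' j, ‖f j ω‖ₑ ∂μ ≠ ∞ := by
      rw [lintegral_tsum fun j => (hf j).1.enorm.aemeasurable]
      refine ne_top_of_le_ne_top hb (ENNReal.tsum_le_tsum fun j => ?_)
      rw [← eLpNorm_one_eq_lintegral_enorm]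
      exact (eLpNorm_le_eLpNorm_of_exponent_le (by norm_num)
        (hf j).1.aestronglyMeasurable).trans (hfb j)
    filter_upwards [ae_lt_top' (Measurable.tsum fun j => (hf j).1.enorm).aemeasurable hint]
      with ω hω
    have h1 : Summable fun j => ‖f j ω‖₊ := ENNReal.tsum_coe_ne_top_iff_summable.1 hω.ne
    exact Summable.of_nnnorm h1
  have hmeas : Measurable fun ω => ∑' j, f j ω := Measurable.tsum fun j => (hf j).1
  refine ⟨hsum, hmeas, hmeas.aestronglyMeasurable, ?_⟩
  -- Fatou's lemma passes the uniform bound on the partial sums to the limit.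
  have hlim := Lp.eLpNorm_lim_le_liminf_eLpNorm (p := 2) (μ := μ)
    (f := fun N ω => ∑ j ∈ Finset.range N, f j ω)
    (fun N => (Finset.measurable_fun_sum _ fun j _ => (hf j).1).aestronglyMeasurable)
    (fun ω => ∑' j, f j ω) (by
      filter_upwards [hsum] with ω hω
      exact hω.hasSum.tendsto_sum_nat)
  refine (hlim.trans ?_).trans_lt hb.lt_top
  refine Filter.liminf_le_of_le (by isBoundedDefault) fun B hB => ?_
  obtain ⟨N, hN⟩ := hB.exists
  refine hN.trans ?_
  have e : (fun ω => ∑ j ∈ Finset.range N, f j ω) = ∑ j ∈ Finset.range N, f j := by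
    funext ω
    simp
  rw [e]
  refine (eLpNorm_sum_le (fun j _ => (hf j).1.aestronglyMeasurable) (by norm_num)).trans ?_
  exact (Finset.sum_le_sum fun j _ => hfb j).trans (ENNReal.sum_le_tsum _)

theorem IsNoise.ae_summable_and_isL2 {W : ℕ → Ω → Vec m} (hW : IsNoise μ W) (wm : Vec m)
    {M : ℕ → Matrix (Fin n) (Fin m) ℝ} {a r : ℝ} (hr0 : 0 ≤ r) (hr1 : r < 1)
    (hM : ∀ j x, ‖(M j).toEuclideanLin x‖ ≤ a * r ^ j * ‖x‖) (g : ℕ → ℕ) :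
    (∀ᵐ ω ∂μ, Summable fun j => (M j).toEuclideanLin (W (g j) ω - wm)) ∧
      IsL2 μ fun ω => ∑' j, (M j).toEuclideanLin (W (g j) ω - wm) := by
  have hL2 : ∀ k, IsL2 μ fun ω => W k ω - wm := fun k => (hW.isL2 k).sub (IsL2.const wm)
  refine ae_summable_and_isL2_tsum (fun j => (hL2 (g j)).toEuclideanLin (M j))
    (b := fun j => ENNReal.ofReal (a * r ^ j) * eLpNorm (fun ω => W 0 ω - wm) 2 μ) ?_ fun j => ?_
  · rw [ENNReal.tsum_mul_right]
    refine ENNReal.mul_ne_top ?_ (hL2 0).2.eLpNorm_ne_top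
    exact ((summable_geometric_of_lt_one hr0 hr1).mul_left a).tsum_ofReal_ne_top
  · have h1 : eLpNorm (fun ω => W (g j) ω - wm) 2 μ = eLpNorm (fun ω => W 0 ω - wm) 2 μ :=
      ((hW.ident (g j)).comp (measurable_id.sub_const wm)).eLpNorm_eq 2
    rw [← h1]
    exact eLpNorm_le_mul_eLpNorm_of_ae_le_mul (Filter.Eventually.of_forall fun ω => hM j _) 2

/-- The closed loop driven by the noise has an invariant law with finite second moments. -/
theorem IsNoise.exists_invariant_law {W : ℕ → Ω → Vec m} (hW : IsNoise μ W) (wm : Vec m)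
    {G : Matrix (Fin n) (Fin n) ℝ} (E : Matrix (Fin n) (Fin m) ℝ) (x₀ : Vec n) {a r : ℝ}
    (ha : 0 ≤ a) (hr0 : 0 ≤ r) (hr1 : r < 1)
    (hG : ∀ (j : ℕ) (x : Vec n), ‖(G ^ j).toEuclideanLin x‖ ≤ a * r ^ j * ‖x‖) :
    ∃ ρ : Measure (Vec n), IsP2 ρ ∧ (ρ.prod (μ.map (W 0))).map
      (fun p => G.toEuclideanLin (p.1 - x₀) + E.toEuclideanLin (p.2 - wm) + x₀) = ρ := by
  obtain ⟨e, he, hE⟩ := norm_toEuclideanLin_le E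
  set M : ℕ → Matrix (Fin n) (Fin m) ℝ := fun j => G ^ j * E with hMdef
  have hM : ∀ j x, ‖(M j).toEuclideanLin x‖ ≤ a * e * r ^ j * ‖x‖ := fun j x => by
    rw [hMdef, toEuclideanLin_mul_apply]
    calc _ ≤ a * r ^ j * ‖E.toEuclideanLin x‖ := hG j _
      _ ≤ a * r ^ j * (e * ‖x‖) := by gcongr; exact hE x
      _ = _ := by ring
  -- The stationary solution as a moving average, with time reversed: `W 0` acts as the latest
  -- noise, so dropping it gives `Z₁`, which has the law of `Z` and is independent of `W 0`. One
  -- closed-loop step sends `Z₁` to `Z` almost surely, hence the law is invariant.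
  set ψ : (ℕ → Vec m) → Vec n := fun w => ∑' j, (M j).toEuclideanLin (w j - wm) + x₀ with hψ
  have hψm : Measurable ψ := by
    refine (Measurable.tsum fun j => ?_).add_const x₀
    have hj : Measurable fun w : ℕ → Vec m => w j := measurable_pi_apply j
    exact (measurable_toEuclideanLin (M j)).comp (hj.sub_const wm)
  have hWm : ∀ k, Measurable (W k) := fun k => (hW.isL2 k).1
  obtain ⟨hs, hZ⟩ := hW.ae_summable_and_isL2 wm hr0 hr1 hM fun j => j
  obtain ⟨hs₁, -⟩ := hW.ae_summable_and_isL2 wm hr0 hr1 hM fun j => j + 1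
  have hseq : Measurable fun ω (j : ℕ) => W j ω := measurable_pi_lambda _ fun j => hWm j
  have hseq₁ : Measurable fun ω (j : ℕ) => W (j + 1) ω := measurable_pi_lambda _ fun j => hWm _
  set Z : Ω → Vec n := fun ω => ψ fun j => W j ω with hZdef
  set Z₁ : Ω → Vec n := fun ω => ψ fun j => W (j + 1) ω with hZ₁def
  have hZL : IsL2 μ Z := hZ.add (IsL2.const x₀)
  have hZ₁m : Measurable Z₁ := hψm.comp hseq₁
  have hlaw : μ.map Z₁ = μ.map Z := by
    have h1 : μ.map Z₁ = (μ.map fun ω (j : ℕ) => W (j + 1) ω).map ψ :=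
      (Measure.map_map hψm hseq₁).symm
    have h2 : μ.map Z = (μ.map fun ω (j : ℕ) => W j ω).map ψ := (Measure.map_map hψm hseq).symm
    rw [h1, h2, hW.map_shift]
  have hind : IndepFun Z₁ (W 0) μ := by
    have h1 := indepFun_tail hW.indep hWm 0
    have h2 : (fun ω (j : ℕ) => W (0 + 1 + j) ω) = fun ω (j : ℕ) => W (j + 1) ω := by
      funext ω j
      rw [zero_add, add_comm]
    rw [h2] at h1
    exact (h1.comp measurable_id hψm).symm
  have hrec : ∀ᵐ ω ∂μ, G.toEuclideanLin (Z₁ ω - x₀) + E.toEuclideanLin (W 0 ω - wm) + x₀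
      = Z ω := by
    filter_upwards [hs, hs₁] with ω h h₁
    simp only [hZdef, hZ₁def, hψ, add_sub_cancel_right]
    rw [h.tsum_eq_zero_add]
    have h2 := G.toEuclideanLin.toContinuousLinearMap.map_tsum h₁
    simp only [LinearMap.coe_toContinuousLinearMap'] at h2
    have h3 : ∀ j, G.toEuclideanLin ((M j).toEuclideanLin (W (j + 1) ω - wm))
        = (M (j + 1)).toEuclideanLin (W (j + 1) ω - wm) := fun j => by
      rw [← toEuclideanLin_mul_apply, hMdef]
      simp only [pow_succ', Matrix.mul_assoc]
    have h4 : M 0 = E := by simp [hMdef]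
    rw [h2, h4]
    simp only [h3]
    rw [add_comm (E.toEuclideanLin _)]
  refine ⟨μ.map Z, hZL.isP2_map, ?_⟩
  rw [← hlaw, ← (indepFun_iff_map_prod_eq_prod_map_map hZ₁m.aemeasurable
    (hWm 0).aemeasurable).1 hind, Measure.map_map _ (hZ₁m.prodMk (hWm 0)), hlaw]
  · exact Measure.map_congr hrec
  · exact (((measurable_toEuclideanLin G).comp (measurable_fst.sub_const x₀)).add
      ((measurable_toEuclideanLin E).comp (measurable_snd.sub_const wm))).add_const x₀

end Decay

/-! ### Construction of the stationary feedback pair -/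

section Existence

variable {n l m : ℕ} {Ω : Type*} [MeasurableSpace Ω] {μ : Measure Ω} [IsProbabilityMeasure μ]
  {S : Problem n l m} {W : ℕ → Ω → Vec m} {xs xt q : Vec n} {us ut : Vec l}
  {P T : Matrix (Fin n) (Fin n) ℝ} {c : ℝ}

/-- The state process under a feedback law. -/
noncomputable def Problem.feedbackTraj (S : Problem n l m) (W : ℕ → Ω → Vec m) (κ : Vec n → Vec l)
    (X₀ : Ω → Vec n) : ℕ → Ω → Vec n
  | 0 => X₀
  | k + 1 => S.step (S.feedbackTraj W κ X₀ k) (fun ω => κ (S.feedbackTraj W κ X₀ k ω)) (W k)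

theorem Problem.IsDesign.exists_feedbackStationaryPair (hW : IsNoise μ W)
    (h : S.IsDesign (∫ ω, W 0 ω ∂μ) xs us P T q xt ut c) (hu : CarriesIndependentUniform μ W) :
    ∃ Xs Us, S.IsFeedbackStationaryPair μ W P xs xt us ut Xs Us := by
  obtain ⟨ξ, hξ, hξlaw, hξind⟩ := hu
  set wm := ∫ ω, W 0 ω ∂μ with hwm
  set G := S.A + S.B * S.gain P with hG
  obtain ⟨a, r, ha, hr0, hr1, hdecay⟩ :=
    exists_norm_pow_le (h.posDef_T.posSemidef_add h.posSemidef_P) h.c_pos h.lyapunov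
  obtain ⟨ρ, hρ, hinv⟩ := hW.exists_invariant_law wm S.E (xt + xs) ha.le hr0 hr1 hdecay
  have := hρ.1
  obtain ⟨f, hf, hfρ⟩ := exists_measurable_map_uniform ρ
  have hWm : ∀ k, Measurable (W k) := fun k => (hW.isL2 k).1
  set κ : Vec n → Vec l := fun x => (S.gain P).toEuclideanLin (x - xt - xs) + ut + us with hκ
  have hκc : Continuous κ := by
    have : Continuous fun x : Vec n => (S.gain P).toEuclideanLin x :=
      (S.gain P).toEuclideanLin.continuous_of_finiteDimensional
    simp only [hκ, map_sub]
    fun_prop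
  set F : Vec n × Vec m → Vec n := fun p =>
    G.toEuclideanLin (p.1 - (xt + xs)) + S.E.toEuclideanLin (p.2 - wm) + (xt + xs) with hF
  have hFm : Measurable F :=
    (((measurable_toEuclideanLin G).comp (measurable_fst.sub_const _)).add
      ((measurable_toEuclideanLin S.E).comp (measurable_snd.sub_const wm))).add_const _
  -- Start from a sample of the invariant law, drawn with the uniform variable, and run the
  -- feedback.
  set X := S.feedbackTraj W κ (fun ω => f (ξ ω)) with hX
  have hsucc : ∀ k, X (k + 1) = fun ω => F (X k ω, W k ω) := fun k => by
    funext ω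
    have e : X (k + 1) ω = S.A.toEuclideanLin (X k ω) + S.B.toEuclideanLin (κ (X k ω))
      + S.E.toEuclideanLin (W k ω) + S.z := rfl
    rw [e]
    have e' : ∀ x, G.toEuclideanLin x
        = S.A.toEuclideanLin x + S.B.toEuclideanLin ((S.gain P).toEuclideanLin x) := fun x => by
      rw [hG, toEuclideanLin_add_apply, toEuclideanLin_mul_apply]
    simp only [hF, hκ, e', map_add, map_sub]
    linear_combination (norm := module) h.steady + h.steady_shift
  have hXm : ∀ k, Measurable (X k) := fun k => by
    induction k with
    | zero => exact hf.comp hξ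
    | succ k ih => rw [hsucc]; exact hFm.comp (ih.prodMk (hWm k))
  have htail : ∀ k, Measurable fun ω (j : ℕ) => W (k + j) ω := fun k =>
    measurable_pi_lambda _ fun j => hWm _
  -- Independence from the entire noise tail, not just from `W k`, is what propagates by induction.
  have hind : ∀ k, IndepFun (X k) (fun ω (j : ℕ) => W (k + j) ω) μ := fun k => by
    induction k with
    | zero =>
      simp only [zero_add]
      exact hξind.comp hf measurable_id
    | succ k ih =>
      have hsplit : Measurable fun w : ℕ → Vec m => (w 0, fun j : ℕ => w (1 + j)) :=
        (measurable_pi_apply 0).prodMk (measurable_pi_lambda _ fun j => measurable_pi_apply _)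
      have h1 : IndepFun (X k) (fun ω => (W k ω, fun j : ℕ => W (k + 1 + j) ω)) μ := by
        have := ih.comp measurable_id hsplit
        simpa only [Function.comp_def, id, add_zero, ← add_assoc] using this
      have h2 := indepFun_prodMk_left (hXm k) (hWm k) (htail (k + 1)) h1
        (indepFun_tail hW.indep hWm k)
      rw [hsucc]
      exact h2.comp hFm measurable_id
  have hindW : ∀ k, IndepFun (X k) (W k) μ := fun k => by
    have := (hind k).comp measurable_id (measurable_pi_apply 0)
    simpa only [Function.comp_def, id, add_zero] using this
  have hlaw : ∀ k, μ.map (X k) = ρ := fun k => by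
    induction k with
    | zero => rw [← hfρ, ← hξlaw, Measure.map_map hf hξ]; rfl
    | succ k ih =>
      have h1 : μ.map (X (k + 1)) = (μ.map fun ω => (X k ω, W k ω)).map F := by
        rw [hsucc, Measure.map_map hFm ((hXm k).prodMk (hWm k))]
        rfl
      rw [h1, (indepFun_iff_map_prod_eq_prod_map_map (hXm k).aemeasurable
        (hWm k).aemeasurable).1 (hindW k), ih, (hW.ident k).map_eq, hinv]
  have hXL : IsL2 μ (X 0) := isL2_of_map (hXm 0) hρ (hlaw 0)
  have hUm : ∀ k, Measurable fun ω => κ (X k ω) := fun k => hκc.measurable.comp (hXm k)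
  have hUL : IsL2 μ fun ω => κ (X 0 ω) :=
    ((((hXL.sub (IsL2.const xt)).sub (IsL2.const xs)).toEuclideanLin (S.gain P)).add
      (IsL2.const ut)).add (IsL2.const us)
  refine ⟨X, fun k ω => κ (X k ω), ?_, fun k ω => rfl⟩
  exact
    { measurable_state := hXm
      measurable_control := hUm
      indep_state := fun k => (hindW k).symm
      indep_control := fun k => ((hindW k).comp hκc.measurable measurable_id).symm
      law_state := ⟨ρ, hρ, hlaw⟩
      law_control := by
        refine ⟨ρ.map κ, ?_, fun k => ?_⟩
        · rw [← hlaw 0, Measure.map_map hκc.measurable (hXm 0)]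
          exact hUL.isP2_map
        · rw [← hlaw k, Measure.map_map hκc.measurable (hXm k)]
          rfl
      dynamics := fun k => rfl }

end Existence

end StochLQ

/-! ### The main theorem -/

theorem mainTheorem4 {n l m : ℕ} {Ω : Type*} [MeasurableSpace Ω]
    (μ : MeasureTheory.Measure Ω) [MeasureTheory.IsProbabilityMeasure μ]
    (S : StochLQ.Problem n l m) (W : ℕ → Ω → StochLQ.Vec m) (hW : StochLQ.IsNoise μ W)
    (hstab : StochLQ.IsStabilizable S.A S.B)
    (hQ₁ : S.Q₁.PosSemidef) (hQ₂ : S.Q₂.PosSemidef) (hR₁ : S.R₁.PosDef) (hR₂ : S.R₂.PosSemidef)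
    (xs : StochLQ.Vec n) (us : StochLQ.Vec l)
    (hsteady : (1 - S.A).toEuclideanLin xs - S.B.toEuclideanLin us =
      S.E.toEuclideanLin (∫ ω, W 0 ω ∂μ) + S.z)
    (hdet : StochLQ.IsDetectable S.A (CFC.sqrt S.Q₁)) :
    ∃ (P T : Matrix (Fin n) (Fin n) ℝ) (q xt : StochLQ.Vec n) (ut : StochLQ.Vec l) (α : ℝ → ℝ),
      S.IsRiccatiSolution P ∧ T.PosDef ∧
      (1 - S.A).toEuclideanLin xt - S.B.toEuclideanLin ut = 0 ∧
      (StochLQ.CarriesIndependentUniform μ W →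
        ∃ Xs Us, S.IsFeedbackStationaryPair μ W P xs xt us ut Xs Us) ∧
      ∀ Xs Us, S.IsFeedbackStationaryPair μ W P xs xt us ut Xs Us →
        S.IsStrictlyDissipative μ W Xs Us (StochLQ.storage μ P T q xs xt Xs) α ∧
        S.TurnpikeInDistribution μ W Xs Us (fun ε => α (Real.sqrt ε)) ∧
        ∀ lam α', S.IsStrictlyDissipative μ W Xs Us lam α' →
          S.TurnpikeInDistribution μ W Xs Us (fun ε => α' (ε ^ 2)) := by
  obtain ⟨P, T, q, xt, ut, c, h⟩ :=
    S.exists_isDesign (∫ ω, W 0 ω ∂μ) hstab hQ₁ hQ₂ hR₁ hR₂ xs us hsteady hdet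
  -- The rate must serve two purposes: `c * min r (r ^ 4) ≤ c * r` keeps dissipativity, and at `√ε`
  -- the fourth power is `ε ^ 2`, so `α (√ε) ≤ c * ε ^ 2`, the bound that the linear rate yields.
  refine ⟨P, T, q, xt, ut, fun r => c * min r (r ^ 4), ⟨h.posSemidef_P, h.riccati⟩, h.posDef_T, ?_,
    h.exists_feedbackStationaryPair hW, fun Xs Us hst => ⟨?_, ?_, fun lam α' hd => ?_⟩⟩
  · rw [StochLQ.toEuclideanLin_sub_apply, StochLQ.toEuclideanLin_one_apply, sub_sub,
      h.steady_shift, sub_self]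
  · exact h.isStrictlyDissipative hW hst (StochLQ.isKInfty_const_mul_min h.c_pos) fun r _ =>
      mul_le_mul_of_nonneg_left (min_le_left _ _) h.c_pos.le
  · refine ((h.isStrictlyDissipative hW hst (StochLQ.isKInfty_const_mul h.c_pos)
      fun r _ => le_rfl).turnpike hW hst.1).mono
      (fun ε hε => (StochLQ.isKInfty_const_mul_min h.c_pos).pos (Real.sqrt_pos.2 hε))
      fun ε hε => mul_le_mul_of_nonneg_left ?_ h.c_pos.le
    have e : Real.sqrt ε ^ 4 = ε ^ 2 := by
      rw [show 4 = 2 * 2 from rfl, pow_mul, Real.sq_sqrt hε.le]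
    exact (min_le_right _ _).trans e.le
  · exact hd.turnpike hW hst.1
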